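/- Let $n\in\mathbb N$, $\alpha\in(0,1)$, $t_0<\vartheta$, $t_*\in[t_0,\vartheta)$. Let $\|\cdot\|$ be a norm on $\mathbb R^n$ with the corresponding matrix norm on $\mathbb R^{n\times n}$, and let $A\in L^\infty([t_0,\vartheta],\mathbb R^{n\times n})$, $b\in L^\infty([t_0,\vartheta],\mathbb R^n)$. For $\beta>0$ let $(I^{\beta}_{a+}\varphi)(t)=\frac1{\Gamma(\beta)}\int_a^t\frac{\varphi(\tau)}{(t-\tau)^{1-\beta}}\,d\tau$ be the Riemann–Liouville fractional integral, and let $({}^CD^{\alpha}_{a+}x)(t)=\frac{d}{dt}\bigl(I^{1-\alpha}_{a+}(x(\cdot)-x(a))\bigr)(t)$ be the Caputo derivative. Write $x\in AC^{\alpha}([a,b],\mathbb R^n)$ if there is $\varphi\in L^\infty([a,b],\mathbb R^n)$ with $x(t)=x(a)+(I^\alpha_{a+}\varphi)(t)$ for all $t\in[a,b]$ (no condition if $a=b$). Let $w_*\in AC^\alpha([t_0,t_*],\mathbb R^n)$. A solution of the Cauchy problem $$({}^CD^\alpha_{t_0+}x)(t)=A(t)x(t)+b(t),\quad t\in[t_*,\vartheta],\qquad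 x(t)=w_*(t),\quad t\in[t_0,t_*],\tag{1}$$ is a function $x\in AC^\alpha([t_0,\vartheta],\mathbb R^n)$ that satisfies the initial condition for every $t\in[t_0,t_*]$ and the differential equation for almost every $t\in[t_*,\vartheta]$. Let $F(t,s)\in\mathbb R^{n\times n}$, $t_0\le s\le t\le\vartheta$, be defined, for each $s\in[t_0,\vartheta]$, as a continuous solution $[s,\vartheta]\ni t\mapsto F(t,s)$ of the integral equation $$F(t,s)=\frac{I}{\Gamma(\alpha)}+\frac{(t-s)^{1-\alpha}}{\Gamma(\alpha)}\int_s^t\frac{A(\tau)F(\tau,s)}{(t-\tau)^{1-\alpha}(\tau-s)^{1-\alpha}}\,d\tau,\qquad t\in[s,\vartheta],\tag{2}$$ where $I$ is the identity matrix. Then such a function $F$ and a solution $x$ of (1) exist, and for every such $F$, every solution $x$ of (1) and every $t\in(t_*,\vartheta]$, $$x(t)=\Bigl(I+\int_{t_*}^t\frac{F(t,\tau)A(\tau)}{(t-\tau)^{1-\alpha}}\,d\tau\Bigr)w_*(t_0) +\frac{\alpha}{\Gamma(1-\alpha)}\int_{t_*}^t\frac{F(t,\tau)}{(t-\tau)^{1-\alpha}}\int_{t_0}^{t_*}\frac{w_*(\xi)-w_*(t_0)}{(\tau-\xi)^{1+\alpha}}\,d\xi\,d\tau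 +\int_{t_*}^t\frac{F(t,\tau)b(\tau)}{(t-\tau)^{1-\alpha}}\,d\tau,$$ where all the integrals converge absolutely (the inner one for every $\tau\in(t_*,t]$). -/

import Mathlib

open MeasureTheory Set
open scoped ENNReal Matrix

/- Vectors in `ℝⁿ` carry the sup norm of `Fin n → ℝ`, and matrices the corresponding operator norm
(all norms on these finite-dimensional spaces are equivalent, so nothing depends on the choice). -/
attribute [local instance] Matrix.linftyOpNormedAddCommGroup Matrix.linftyOpNormedSpace

noncomputable section

/-- `φ ∈ L^∞([a, b], X)`: Lebesgue measurable and essentially bounded on `[a, b]`.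
No condition at all if `a = b`. -/
def MemLinf {X : Type*} [NormedAddCommGroup X] (a b : ℝ) (φ : ℝ → X) : Prop :=
  MemLp φ ∞ (volume.restrict (Icc a b))

/-- `φ ∈ C([a, b], X)`. -/
def MemC {X : Type*} [NormedAddCommGroup X] (a b : ℝ) (φ : ℝ → X) : Prop :=
  ContinuousOn φ (Icc a b)

/-- The integral `∫_a^b φ(τ) dτ` converges absolutely. -/
def IntegralConverges {X : Type*} [NormedAddCommGroup X] (a b : ℝ) (φ : ℝ → X) : Prop :=
  IntervalIntegrable φ volume a b

/-- The left-sided Riemann–Liouville fractional integral of order `β > 0`,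
`(I^β_{a+} φ)(t) = (1 / Γ(β)) ∫_a^t φ(τ) (t - τ)^{β - 1} dτ`. -/
def rlIntegral {X : Type*} [NormedAddCommGroup X] [NormedSpace ℝ X]
    (β a : ℝ) (φ : ℝ → X) (t : ℝ) : X :=
  (1 / Real.Gamma β) • ∫ τ in a..t, (t - τ) ^ (β - 1) • φ τ

/-- `x ∈ AC^α([a, b], X)`: there is `φ ∈ L^∞([a, b], X)` with `x = x(a) + I^α_{a+} φ` on `[a, b]`. -/
def MemAC {X : Type*} [NormedAddCommGroup X] [NormedSpace ℝ X]
    (α a b : ℝ) (x : ℝ → X) : Prop :=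
  ∃ φ : ℝ → X, MemLinf a b φ ∧ ∀ t ∈ Icc a b, x t = x a + rlIntegral α a φ t

/-- The left-sided Caputo derivative `(ᶜD^α_{a+} x)(t) = d/dt (I^{1-α}_{a+} (x(·) - x(a)))(t)`
exists at `t` and equals `v`. -/
def HasCaputoDerivAt {X : Type*} [NormedAddCommGroup X] [NormedSpace ℝ X]
    (α a : ℝ) (x : ℝ → X) (v : X) (t : ℝ) : Prop :=
  HasDerivAt (rlIntegral (1 - α) a (fun τ => x τ - x a)) v t

/-- `x` solves the Cauchy problem `(ᶜD^α_{t₀+} x)(t) = A(t) x(t) + b(t)` for a.e. `t ∈ [t⋆, ϑ]`,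
`x(t) = w(t)` for `t ∈ [t₀, t⋆]`, in the class `AC^α([t₀, ϑ], ℝⁿ)`. -/
structure IsCauchySolution {n : ℕ} (α t₀ ϑ tstar : ℝ) (A : ℝ → Matrix (Fin n) (Fin n) ℝ)
    (b w x : ℝ → Fin n → ℝ) : Prop where
  memAC : MemAC α t₀ ϑ x
  initial : ∀ t ∈ Icc t₀ tstar, x t = w t
  equation : ∀ᵐ t ∂(volume.restrict (Icc tstar ϑ)), HasCaputoDerivAt α t₀ x (A t *ᵥ x t + b t) t

/-- `F`, on `Ω = {(t, s) : t₀ ≤ s ≤ t ≤ ϑ}`, is the (regularized) fundamental solution matrix: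
for every `s ∈ [t₀, ϑ]`, the function `F(·, s)` is a continuous solution on `[s, ϑ]` of
`F(t, s) = I / Γ(α) + ((t - s)^{1-α} / Γ(α)) ∫_s^t A(τ) F(τ, s) (t - τ)^{α-1} (τ - s)^{α-1} dτ`. -/
structure IsFundamentalMatrix {n : ℕ} (α t₀ ϑ : ℝ) (A : ℝ → Matrix (Fin n) (Fin n) ℝ)
    (F : ℝ → ℝ → Matrix (Fin n) (Fin n) ℝ) : Prop where
  continuousOn : ∀ s ∈ Icc t₀ ϑ, MemC s ϑ (fun t => F t s)
  equation : ∀ s ∈ Icc t₀ ϑ, ∀ t ∈ Icc s ϑ,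
    F t s = (1 / Real.Gamma α) • (1 : Matrix (Fin n) (Fin n) ℝ)
      + ((t - s) ^ (1 - α) / Real.Gamma α) •
        ∫ τ in s..t, ((t - τ) ^ (α - 1) * (τ - s) ^ (α - 1)) • (A τ * F τ s)

end

open ProbabilityTheory (beta beta_pos)
open Filter Topology
open scoped Interval

/-! ### Scalar kernels -/

/-! Put a = t₀, s = t⋆, v = w(a), and write x = v + I^α φ with φ bounded. Since I^{1-α} I^α is
ordinary integration (`rlIntegral_rlIntegral`), Lebesgue differentiation identifies the Caputo
derivative with φ almost everywhere (`ae_hasCaputoDerivAt_iff`). The differential equation therefore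
says φ = A x + b a.e. after s.

The history enters through one identity, `integral_memory`: for t > s, the part of I^α φ coming from
[a, s] equals a fractional integral started at s, whose density is the memory term h(τ) = α/Γ(1-α)
∫_a^s (τ-ξ)^{-1-α} u(ξ) dξ with u = I^α φ. It follows from two applications of Fubini and a
fractional linear substitution reducing the last integral to a beta function. Hence y = x - v
satisfies y = (1/Γ(α)) ∫_s^t (t-τ)^{α-1} (A y + g) dτ with g = A v + h + b, where g may blow up at s
like (τ-s)^{-α}, which the kernel can still integrate.

This Volterra equation is solved by z(t) = ∫_s^t (t-σ)^{α-1} R(t,σ) g(σ) dσ, with R the fundamental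
matrix (`variation_of_constants`, Fubini again), and its bounded solutions are unique
(`eqOn_of_volterra`). So y = z, and splitting g into its three summands gives the formula. Existence
reverses the argument: the density built from z is glued to that of w (`exists_solution`).

Both the existence of R and uniqueness rest on the regularized operator `volterraOp`: in a sup norm
weighted by exp(λ(t-s)) it halves norms once λ is large. The Neumann series yields a bounded and
jointly measurable R (`exists_resolvent`), as Fubini requires. An arbitrary F is only assumed
continuous in t, but uniqueness identifies it with R off the diagonal
(`IsFundamentalMatrix.eq_resolvent`). -/

theorem integral_betaKernel {s t a b : ℝ} (hst : s < t) (ha : 0 < a) (hb : 0 < b) :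
    ∫ τ in s..t, (t - τ) ^ (a - 1) * (τ - s) ^ (b - 1) = (t - s) ^ (a + b - 1) * beta a b := by
  have hT : 0 < t - s := sub_pos.2 hst
  have h0 : ∫ τ in s..t, (t - τ) ^ (a - 1) * (τ - s) ^ (b - 1)
      = ∫ x in (0 : ℝ)..(t - s), x ^ (b - 1) * ((t - s) - x) ^ (a - 1) := by
    have := intervalIntegral.integral_comp_sub_right (a := s) (b := t)
      (fun x : ℝ => x ^ (b - 1) * ((t - s) - x) ^ (a - 1)) s
    rw [sub_self] at this
    rw [← this]
    refine intervalIntegral.integral_congr fun x _ => ?_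
    rw [mul_comm]
    congr 2
    ring
  have h1 := Complex.betaIntegral_scaled (b : ℂ) (a : ℂ) hT
  have h2 : ∫ x in (0 : ℝ)..(t - s), (x : ℂ) ^ ((b : ℂ) - 1) * (((t - s : ℝ) : ℂ) - x) ^ ((a : ℂ) - 1)
      = ((∫ x in (0 : ℝ)..(t - s), x ^ (b - 1) * ((t - s) - x) ^ (a - 1) : ℝ) : ℂ) := by
    rw [← intervalIntegral.integral_ofReal]
    refine intervalIntegral.integral_congr fun x hx => ?_
    rw [uIcc_of_le hT.le] at hx
    rw [← Complex.ofReal_sub, Complex.ofReal_mul, Complex.ofReal_cpow hx.1,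
      Complex.ofReal_cpow (sub_nonneg.2 hx.2)]
    push_cast
    rfl
  rw [h2] at h1
  rw [h0, ProbabilityTheory.beta_eq_betaIntegralReal a b ha hb, Complex.betaIntegral_symm]
  have h3 := congrArg Complex.re h1
  rw [Complex.ofReal_re] at h3
  rw [h3, show ((b : ℂ) + a - 1) = ((a + b - 1 : ℝ) : ℂ) by push_cast; ring,
    ← Complex.ofReal_cpow hT.le, Complex.re_ofReal_mul]

theorem intervalIntegrable_betaKernel {s t a b : ℝ} (hst : s ≤ t) (ha : 0 < a) (hb : 0 < b) :
    IntervalIntegrable (fun τ => (t - τ) ^ (a - 1) * (τ - s) ^ (b - 1)) volume s t := by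
  rcases hst.eq_or_lt with rfl | hst
  · exact IntervalIntegrable.refl
  -- A nonintegrable function has integral zero by convention, so the nonzero beta value certifies
  -- integrability.
  refine intervalIntegral.intervalIntegrable_of_integral_ne_zero ?_
  rw [integral_betaKernel hst ha hb]
  exact (mul_pos (Real.rpow_pos_of_pos (sub_pos.2 hst) _) (beta_pos ha hb)).ne'

theorem intervalIntegrable_leftKernel {c t a : ℝ} (r : ℝ) (ha : 0 < a) :
    IntervalIntegrable (fun τ => (t - τ) ^ (a - 1)) volume c r := by
  have h : IntervalIntegrable (fun x : ℝ => x ^ (a - 1)) volume (t - c) (t - r) :=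
    intervalIntegral.intervalIntegrable_rpow' (by linarith)
  simpa using h.comp_sub_left t

theorem integral_leftKernel {c t a : ℝ} (ha : 0 < a) (r : ℝ) :
    ∫ τ in c..r, (t - τ) ^ (a - 1) = ((t - c) ^ a - (t - r) ^ a) / a := by
  rw [intervalIntegral.integral_comp_sub_left (fun x : ℝ => x ^ (a - 1)) t,
    integral_rpow (Or.inl (by linarith))]
  simp

/-- The exponentially weighted beta kernel is small for large `lam`. -/
theorem integral_betaKernel_mul_exp_le {s t α lam : ℝ} (hst : s < t) (hα : α ∈ Ioo (0 : ℝ) 1)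
    (hl : 0 < lam) :
    IntervalIntegrable (fun τ => (t - τ) ^ (α - 1) * (τ - s) ^ (α - 1) * Real.exp (lam * (τ - s)))
      volume s t ∧
    (t - s) ^ (1 - α) * ∫ τ in s..t, (t - τ) ^ (α - 1) * (τ - s) ^ (α - 1) *
        Real.exp (lam * (τ - s))
      ≤ lam ^ (-(α / 2)) * (t - s) ^ (α / 2) * beta (α / 2) α * Real.exp (lam * (t - s)) := by
  obtain ⟨h0, h1⟩ := hα
  have hT : 0 < t - s := sub_pos.2 hst
  have hint : IntervalIntegrable
      (fun τ => (t - τ) ^ (α - 1) * (τ - s) ^ (α - 1) * Real.exp (lam * (τ - s))) volume s t :=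
    (intervalIntegrable_betaKernel hst.le h0 h0).mul_continuousOn (by fun_prop)
  refine ⟨hint, ?_⟩
  have key : ∫ τ in s..t, (t - τ) ^ (α - 1) * (τ - s) ^ (α - 1) * Real.exp (lam * (τ - s))
      ≤ ∫ τ in s..t, lam ^ (-(α / 2)) * Real.exp (lam * (t - s)) *
          ((t - τ) ^ (α / 2 - 1) * (τ - s) ^ (α - 1)) := by
    refine intervalIntegral.integral_mono_on_of_le_Ioo hst.le hint
      ((intervalIntegrable_betaKernel hst.le (by linarith) h0).const_mul _) fun τ hτ => ?_
    have hr : 0 < t - τ := sub_pos.2 hτ.2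
    have hx : 0 < lam * (t - τ) := mul_pos hl hr
    -- Half of the exponent α is sacrificed: exp(-λr) ≤ (λr)^{-α/2} leaves the integrable kernel
    -- r^{α/2-1} and gains the decaying factor λ^{-α/2}.
    have h2 : (lam * (t - τ)) ^ (α / 2) ≤ Real.exp (lam * (t - τ)) := by
      rw [Real.rpow_def_of_pos hx, Real.exp_le_exp]
      have := Real.log_le_sub_one_of_pos hx
      nlinarith
    have h3 : Real.exp (lam * (τ - s)) =
        Real.exp (lam * (t - s)) * (Real.exp (lam * (t - τ)))⁻¹ := by
      rw [← Real.exp_neg, ← Real.exp_add]; congr 1; ring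
    have h4 : (Real.exp (lam * (t - τ)))⁻¹ ≤ lam ^ (-(α / 2)) * (t - τ) ^ (-(α / 2)) := by
      rw [← Real.mul_rpow hl.le hr.le, Real.rpow_neg hx.le]
      exact inv_anti₀ (Real.rpow_pos_of_pos hx _) h2
    have h5 : (t - τ) ^ (α / 2 - 1) = (t - τ) ^ (α - 1) * (t - τ) ^ (-(α / 2)) := by
      rw [← Real.rpow_add hr]; congr 1; ring
    rw [h3, h5]
    have : 0 ≤ (t - τ) ^ (α - 1) * (τ - s) ^ (α - 1) * Real.exp (lam * (t - s)) := by
      have := hτ.1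
      have : 0 ≤ τ - s := by linarith
      positivity
    calc _ = (t - τ) ^ (α - 1) * (τ - s) ^ (α - 1) * Real.exp (lam * (t - s)) *
          (Real.exp (lam * (t - τ)))⁻¹ := by ring
      _ ≤ _ := mul_le_mul_of_nonneg_left h4 this
      _ = _ := by ring
  rw [intervalIntegral.integral_const_mul, integral_betaKernel hst (by linarith) h0] at key
  refine (mul_le_mul_of_nonneg_left key (Real.rpow_nonneg hT.le _)).trans_eq ?_
  have : (t - s) ^ (α / 2) = (t - s) ^ (1 - α) * (t - s) ^ (α / 2 + α - 1) := by
    rw [← Real.rpow_add hT]; congr 1; ring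
  rw [this]; ring

/-- An integral reducing to the beta function by a fractional linear substitution. -/
theorem integral_betaKernel_div {η s t α : ℝ} (hηs : η < s) (hst : s < t)
    (hα : α ∈ Ioo (0 : ℝ) 1) :
    IntervalIntegrable (fun ξ => (s - ξ) ^ (-α) * (ξ - η) ^ (α - 1) * (t - ξ)⁻¹) volume η s ∧
    ∫ ξ in η..s, (s - ξ) ^ (-α) * (ξ - η) ^ (α - 1) * (t - ξ)⁻¹
      = beta (1 - α) α * ((t - s) ^ (-α) * (t - η) ^ (α - 1)) := by
  obtain ⟨h0, h1⟩ := hα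
  have hb : 0 < s - η := sub_pos.2 hηs
  have hc : 0 < t - s := sub_pos.2 hst
  have hd : 0 < t - η := by linarith
  have hint : IntervalIntegrable (fun ξ => (s - ξ) ^ (-α) * (ξ - η) ^ (α - 1) * (t - ξ)⁻¹)
      volume η s := by
    have := intervalIntegrable_betaKernel hηs.le (sub_pos.2 h1) h0
    rw [show 1 - α - 1 = -α by ring] at this
    refine this.mul_continuousOn (ContinuousOn.inv₀ (by fun_prop) fun x hx => ?_)
    rw [uIcc_of_le hηs.le] at hx
    have := hx.2
    exact (by linarith : 0 < t - x).ne'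
  refine ⟨hint, ?_⟩
  -- The Möbius map sending η, s, t to 0, 1, ∞. Both v and 1 - v factor, so the integrand becomes a
  -- constant times (1-v)^{-α} v^{α-1} dv.
  set v : ℝ → ℝ := fun x => (x - η) * (t - s) / ((s - η) * (t - x)) with hv
  have hderiv : ∀ x ∈ Ioo η s, HasDerivWithinAt v
      ((t - s) * (t - η) / ((s - η) * (t - x) ^ 2)) (Ioo η s) x := fun x hx => by
    have hx' : t - x ≠ 0 := by have := hx.2; exact (by linarith : 0 < t - x).ne'
    have h1 : HasDerivAt (fun x : ℝ => (x - η) * (t - s)) (t - s) x := by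
      simpa using ((hasDerivAt_id x).sub_const η).mul_const (t - s)
    have h2 : HasDerivAt (fun x : ℝ => (s - η) * (t - x)) (-(s - η)) x := by
      simpa using ((hasDerivAt_id x).const_sub t).const_mul (s - η)
    refine (((h1.div h2 (mul_ne_zero hb.ne' hx')).hasDerivWithinAt).congr_deriv ?_)
    field_simp
    ring
  have hpos : ∀ x ∈ Ioo η s, 0 < (s - η) * (t - x) := fun x hx =>
    mul_pos hb (by have := hx.2; linarith)
  have hone : ∀ x ∈ Ioo η s, 1 - v x = (t - η) * (s - x) / ((s - η) * (t - x)) := fun x hx => by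
    have := (hpos x hx).ne'
    rw [hv]; simp only
    rw [eq_div_iff this, sub_mul, div_mul_cancel₀ _ this]; ring
  have hinj : InjOn v (Ioo η s) := fun x hx y hy hxy => by
    have hx' := (hpos x hx).ne'
    have hy' := (hpos y hy).ne'
    rw [hv] at hxy; simp only at hxy
    rw [div_eq_div_iff hx' hy'] at hxy
    have : ((t - s) * (s - η) * (t - η)) * (x - y) = 0 := by linear_combination hxy
    have h3 : (t - s) * (s - η) * (t - η) ≠ 0 := by positivity
    linarith [(mul_eq_zero.1 this).resolve_left h3]
  have himg : v '' Ioo η s = Ioo 0 1 := by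
    ext y; constructor
    · rintro ⟨x, hx, rfl⟩
      constructor
      · exact div_pos (mul_pos (sub_pos.2 hx.1) hc) (hpos x hx)
      · have := hone x hx
        have h3 : 0 < (t - η) * (s - x) / ((s - η) * (t - x)) :=
          div_pos (mul_pos hd (sub_pos.2 hx.2)) (hpos x hx)
        linarith
    · intro hy
      have hD : 0 < (t - s) + y * (s - η) := by have := mul_pos hy.1 hb; linarith
      refine ⟨η + y * (s - η) * (t - η) / ((t - s) + y * (s - η)), ⟨?_, ?_⟩, ?_⟩
      · have := hy.1
        have : 0 < y * (s - η) * (t - η) / ((t - s) + y * (s - η)) := by positivity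
        linarith
      · rw [← lt_sub_iff_add_lt', div_lt_iff₀ hD]
        nlinarith [mul_pos (mul_pos (sub_pos.2 hy.2) hb) hc]
      · rw [hv]; simp only
        have e1 : t - (η + y * (s - η) * (t - η) / ((t - s) + y * (s - η)))
          = (t - η) * (t - s) / ((t - s) + y * (s - η)) := by
          field_simp; ring
        rw [e1]
        have := hD.ne'
        field_simp
        ring
  have hch := integral_image_eq_integral_abs_deriv_smul measurableSet_Ioo hderiv hinj
    (fun y : ℝ => (1 - y) ^ (1 - α - 1) * (y - 0) ^ (α - 1))
  rw [himg, ← integral_Ioc_eq_integral_Ioo, ← intervalIntegral.integral_of_le zero_le_one,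
    integral_betaKernel zero_lt_one (sub_pos.2 h1) h0] at hch
  simp only [sub_zero, Real.one_rpow, one_mul] at hch
  rw [hch, intervalIntegral.integral_of_le hηs.le, integral_Ioc_eq_integral_Ioo,
    ← integral_mul_const]
  refine setIntegral_congr_fun measurableSet_Ioo fun x hx => ?_
  have hp := hpos x hx
  have hx1 : 0 < x - η := sub_pos.2 hx.1
  have hx2 : 0 < s - x := sub_pos.2 hx.2
  have hx3 : 0 < t - x := by linarith
  simp only [smul_eq_mul]
  rw [hone x hx, show 1 - α - 1 = -α by ring, hv, abs_of_pos (by positivity)]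
  simp only
  rw [Real.div_rpow (by positivity) (by positivity), Real.div_rpow (by positivity) (by positivity),
    Real.mul_rpow hd.le hx2.le, Real.mul_rpow hx1.le hc.le, Real.rpow_sub_one hp.ne',
    Real.rpow_sub_one hc.ne', Real.rpow_sub_one hd.ne', Real.rpow_neg hp.le,
    Real.rpow_neg hd.le, Real.rpow_neg hc.le]
  have := Real.rpow_pos_of_pos hp α
  have := Real.rpow_pos_of_pos hd α
  have := Real.rpow_pos_of_pos hc α
  field_simp

/-- An elementary antiderivative exists, because ((t-τ)/(τ-r))^α has derivative
-α(t-r)(t-τ)^{α-1}(τ-r)^{-1-α}. This is the inner integral when the memory term is integrated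
against the kernel. -/
theorem integral_rpow_div_rpow {s t r α : ℝ} (hrs : r < s) (hst : s < t) (hα : 0 < α) :
    IntervalIntegrable (fun τ => (t - τ) ^ (α - 1) * (τ - r) ^ (-1 - α)) volume s t ∧
    ∫ τ in s..t, (t - τ) ^ (α - 1) * (τ - r) ^ (-1 - α)
      = (t - s) ^ α / (α * ((t - r) * (s - r) ^ α)) := by
  have hd : 0 < t - r := by linarith
  have hint : IntervalIntegrable (fun τ => (t - τ) ^ (α - 1) * (τ - r) ^ (-1 - α)) volume s t := by
    refine (intervalIntegrable_leftKernel t hα).mul_continuousOn ?_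
    refine ContinuousOn.rpow_const (by fun_prop) fun x hx => Or.inl ?_
    rw [uIcc_of_le hst.le] at hx
    have := hx.1
    exact (by linarith : 0 < x - r).ne'
  refine ⟨hint, ?_⟩
  have := intervalIntegral.integral_eq_sub_of_hasDerivAt_of_le (a := s) (b := t)
    (f := fun τ => -((t - τ) / (τ - r)) ^ α / (α * (t - r)))
    (f' := fun τ => (t - τ) ^ (α - 1) * (τ - r) ^ (-1 - α)) hst.le ?_ ?_ hint
  · rw [this]
    have h1 : 0 < s - r := by linarith
    have h2 : 0 < t - s := by linarith
    have := Real.rpow_pos_of_pos h1 α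
    rw [Real.div_rpow h2.le h1.le, sub_self, zero_div, Real.zero_rpow hα.ne']
    field_simp
    ring
  · refine ContinuousOn.div_const (ContinuousOn.neg (ContinuousOn.rpow_const
      (ContinuousOn.div (by fun_prop) (by fun_prop) fun x hx => ?_) fun x _ => Or.inr hα.le)) _
    have := hx.1
    exact (by linarith : 0 < x - r).ne'
  · intro x hx
    have hx1 : 0 < t - x := sub_pos.2 hx.2
    have hx2 : 0 < x - r := by have := hx.1; linarith
    have h1 : HasDerivAt (fun τ : ℝ => (t - τ) / (τ - r)) (-(t - r) / (x - r) ^ 2) x := by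
      refine (((hasDerivAt_id x).const_sub t).div ((hasDerivAt_id x).sub_const r) hx2.ne').congr_deriv
        ?_
      simp only [id]
      congr 1
      ring
    have h2 := ((h1.rpow_const (p := α) (Or.inl (div_pos hx1 hx2).ne')).neg.div_const (α * (t - r)))
    refine h2.congr_deriv ?_
    rw [Real.div_rpow hx1.le hx2.le, Real.rpow_sub_one hx2.ne', sub_eq_add_neg (-1 : ℝ) α,
      Real.rpow_add hx2, Real.rpow_neg_one, Real.rpow_neg hx2.le]
    have := Real.rpow_pos_of_pos hx2 α
    field_simp

/-! ### Measurability, integrability and Fubini on a triangle -/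

theorem stronglyMeasurable_intervalIntegral {P E : Type*} [MeasurableSpace P]
    [NormedAddCommGroup E] [NormedSpace ℝ E] {f : P → ℝ → E}
    (hf : StronglyMeasurable (Function.uncurry f)) {l r : P → ℝ} (hl : Measurable l)
    (hr : Measurable r) : StronglyMeasurable fun p => ∫ τ in l p..r p, f p τ := by
  have key : ∀ {l r : P → ℝ}, Measurable l → Measurable r →
      StronglyMeasurable fun p => ∫ τ in Ioc (l p) (r p), f p τ := by
    intro l r hl hr
    have hS : MeasurableSet {q : P × ℝ | l q.1 < q.2 ∧ q.2 ≤ r q.1} :=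
      (measurableSet_lt (hl.comp measurable_fst) measurable_snd).inter
        (measurableSet_le measurable_snd (hr.comp measurable_fst))
    have := (hf.indicator hS).integral_prod_right' (ν := (volume : Measure ℝ))
    convert this using 2 with p
    rw [← integral_indicator measurableSet_Ioc]
    rfl
  exact (key hl hr).sub (key hr hl)

/-- Truncating a measurable representative at the essential supremum removes exceptional sets: all
later estimates can assume measurability and a bound everywhere. -/
theorem MemLinf.exists_bounded_version {X : Type*} [NormedAddCommGroup X] {a b : ℝ} {φ : ℝ → X}
    (hφ : MemLinf a b φ) : ∃ (ψ : ℝ → X) (C : ℝ), StronglyMeasurable ψ ∧ 0 ≤ C ∧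
      (∀ x, ‖ψ x‖ ≤ C) ∧ ∀ᵐ x ∂(volume.restrict (Icc a b)), ψ x = φ x := by
  set C : ℝ := (eLpNorm φ ∞ (volume.restrict (Icc a b))).toReal
  have hC : 0 ≤ C := ENNReal.toReal_nonneg
  have hm := hφ.1.stronglyMeasurable_mk
  have hS : MeasurableSet {x | ‖hφ.1.mk φ x‖ ≤ C} :=
    measurableSet_le hm.norm.measurable measurable_const
  refine ⟨{x | ‖hφ.1.mk φ x‖ ≤ C}.indicator (hφ.1.mk φ), C, hm.indicator hS, hC, fun x => ?_, ?_⟩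
  · by_cases hx : x ∈ {x | ‖hφ.1.mk φ x‖ ≤ C}
    · rw [indicator_of_mem hx]; exact hx
    · rw [indicator_of_notMem hx, norm_zero]; exact hC
  · have h2 : ∀ᵐ x ∂(volume.restrict (Icc a b)), ‖φ x‖ ≤ C := by
      have h3 := hφ.2.ne
      filter_upwards [ae_le_eLpNormEssSup (f := φ) (μ := volume.restrict (Icc a b))] with x hx
      rw [← eLpNorm_exponent_top] at hx
      rw [← toReal_enorm]
      exact ENNReal.toReal_mono h3 hx
    filter_upwards [hφ.1.ae_eq_mk, h2] with x hx1 hx2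
    rw [indicator_of_mem, hx1]
    rw [mem_ofPred_eq, ← hx1]; exact hx2

theorem memLinf_of_bounded {X : Type*} [NormedAddCommGroup X] {a b C : ℝ} {φ : ℝ → X}
    (hφ : StronglyMeasurable φ) (hC : ∀ x, ‖φ x‖ ≤ C) : MemLinf a b φ :=
  memLp_top_of_bound hφ.aestronglyMeasurable C (Eventually.of_forall hC)

/-! ### Estimates and Fubini for singular kernels -/

section Bound

variable {E : Type*} [NormedAddCommGroup E] [NormedSpace ℝ E] {s t C : ℝ} {k : ℝ → ℝ} {f : ℝ → E}

theorem ae_restrict_uIoc_of_forall_Ioo {p : ℝ → Prop} (hst : s ≤ t) (h : ∀ τ ∈ Ioo s t, p τ) :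
    ∀ᵐ τ ∂(volume.restrict (Ι s t)), p τ := by
  rw [uIoc_of_le hst, ← restrict_Ioo_eq_restrict_Ioc]
  exact ae_restrict_of_forall_mem measurableSet_Ioo h

theorem intervalIntegrable_smul_of_bound (hst : s ≤ t) (hk : IntervalIntegrable k volume s t)
    (hk0 : ∀ τ ∈ Ioo s t, 0 ≤ k τ) (hf : AEStronglyMeasurable f (volume.restrict (Ioc s t)))
    (hC : ∀ τ ∈ Ioo s t, ‖f τ‖ ≤ C) : IntervalIntegrable (fun τ => k τ • f τ) volume s t := by
  refine (hk.const_mul C).mono_fun' ?_ ?_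
  · rw [uIoc_of_le hst]
    exact hk.1.aestronglyMeasurable.smul hf
  · refine ae_restrict_uIoc_of_forall_Ioo hst fun τ hτ => ?_
    beta_reduce
    rw [norm_smul, Real.norm_of_nonneg (hk0 τ hτ), mul_comm]
    exact mul_le_mul_of_nonneg_right (hC τ hτ) (hk0 τ hτ)

theorem norm_integral_smul_le {g : ℝ → ℝ} (hst : s ≤ t)
    (hk : IntervalIntegrable (fun τ => k τ * g τ) volume s t)
    (hk0 : ∀ τ ∈ Ioo s t, 0 ≤ k τ) (hC : ∀ τ ∈ Ioo s t, ‖f τ‖ ≤ g τ) :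
    ‖∫ τ in s..t, k τ • f τ‖ ≤ ∫ τ in s..t, k τ * g τ := by
  refine intervalIntegral.norm_integral_le_of_norm_le hst ?_ hk
  have := ae_restrict_uIoc_of_forall_Ioo (p := fun τ => ‖k τ • f τ‖ ≤ k τ * g τ) hst
    fun τ hτ => by
      rw [norm_smul, Real.norm_of_nonneg (hk0 τ hτ)]
      exact mul_le_mul_of_nonneg_left (hC τ hτ) (hk0 τ hτ)
  rw [uIoc_of_le hst] at this
  exact (ae_restrict_iff' measurableSet_Ioc).1 this

theorem norm_integral_smul_le_const (hst : s ≤ t) (hk : IntervalIntegrable k volume s t)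
    (hk0 : ∀ τ ∈ Ioo s t, 0 ≤ k τ) (hC : ∀ τ ∈ Ioo s t, ‖f τ‖ ≤ C) :
    ‖∫ τ in s..t, k τ • f τ‖ ≤ (∫ τ in s..t, k τ) * C := by
  rw [← intervalIntegral.integral_mul_const]
  exact norm_integral_smul_le hst (hk.mul_const C) hk0 hC

theorem intervalIntegral_congr_Ioo {f g : ℝ → E} (hst : s ≤ t) (h : ∀ τ ∈ Ioo s t, f τ = g τ) :
    ∫ τ in s..t, f τ = ∫ τ in s..t, g τ := by
  rw [intervalIntegral.integral_of_le hst, intervalIntegral.integral_of_le hst,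
    integral_Ioc_eq_integral_Ioo, integral_Ioc_eq_integral_Ioo]
  exact setIntegral_congr_fun measurableSet_Ioo h

theorem integral_eq_integral_Ioo (hst : s ≤ t) : ∫ τ in s..t, f τ = ∫ τ in Ioo s t, f τ := by
  rw [intervalIntegral.integral_of_le hst, integral_Ioc_eq_integral_Ioo]

theorem setIntegral_indicator_lt {τ : ℝ} (hτ : τ ∈ Ioo s t) (g : ℝ × ℝ → E) :
    ∫ σ in Ioo s t, {p : ℝ × ℝ | p.2 < p.1}.indicator g (τ, σ) = ∫ σ in s..τ, g (τ, σ) := by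
  have h1 : (fun σ => {p : ℝ × ℝ | p.2 < p.1}.indicator g (τ, σ))
    = (Iio τ).indicator fun σ => g (τ, σ) := rfl
  rw [h1, setIntegral_indicator measurableSet_Iio, integral_eq_integral_Ioo hτ.1.le]
  congr 2
  rw [Ioo_inter_Iio, min_eq_right hτ.2.le]

/-- The majorant is integrable on the triangle: its inner integral is a beta integral proportional
to (τ-s)^{b+c-1}, leaving an outer beta integral with exponents a and b + c. The parameter c admits
a singularity at s; c = 1 means there is none. -/
theorem integral_triangle_swap {a b c : ℝ} (hst : s ≤ t) (ha : 0 < a) (hb : 0 < b)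
    (hc : 0 < c) (hC0 : 0 ≤ C) {f : ℝ → ℝ → E} (hf : StronglyMeasurable (Function.uncurry f))
    (hC : ∀ τ σ, s < σ → σ < τ → τ < t →
      ‖f τ σ‖ ≤ C * ((t - τ) ^ (a - 1) * ((τ - σ) ^ (b - 1) * (σ - s) ^ (c - 1)))) :
    ∫ τ in s..t, ∫ σ in s..τ, f τ σ = ∫ σ in s..t, ∫ τ in σ..t, f τ σ := by
  set S : Set (ℝ × ℝ) := {p | p.2 < p.1} with hS
  have hSm : MeasurableSet S := measurableSet_lt measurable_snd measurable_fst
  set M : ℝ × ℝ → ℝ := fun p =>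
    C * ((t - p.1) ^ (a - 1) * ((p.1 - p.2) ^ (b - 1) * (p.2 - s) ^ (c - 1))) with hM
  have hMm : Measurable M := by
    refine Measurable.const_mul ?_ C
    refine Measurable.mul (Measurable.pow_const (by fun_prop) _)
      (Measurable.mul (Measurable.pow_const (by fun_prop) _) (Measurable.pow_const (by fun_prop) _))
  set μ : Measure ℝ := volume.restrict (Ioo s t) with hμ
  have hsec' : ∀ σ ∈ Ioo s t, ∫ τ, S.indicator (Function.uncurry f) (τ, σ) ∂μ
      = ∫ τ in σ..t, f τ σ := by
    intro σ hσ
    have h1 : (fun τ => S.indicator (Function.uncurry f) (τ, σ))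
      = (Ioi σ).indicator fun τ => f τ σ := rfl
    rw [h1, hμ, setIntegral_indicator measurableSet_Ioi, integral_eq_integral_Ioo hσ.2.le]
    congr 2
    rw [inter_comm, Ioi_inter_Ioo, max_eq_left hσ.1.le]
  have hMnn : ∀ τ ∈ Ioo s t, ∀ σ ∈ Ioo s τ, 0 ≤ M (τ, σ) := fun τ hτ σ hσ => by
    have h1 : 0 ≤ t - τ := by linarith [hτ.2]
    have h2 : 0 ≤ τ - σ := by linarith [hσ.2]
    have h3 : 0 ≤ σ - s := by linarith [hσ.1]
    simp only [hM]
    positivity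
  have hMint : Integrable (S.indicator M) (μ.prod μ) := by
    rw [integrable_prod_iff (hMm.indicator hSm).aestronglyMeasurable]
    constructor
    · refine ae_restrict_of_forall_mem measurableSet_Ioo fun τ hτ => ?_
      have h1 : (fun σ => S.indicator M (τ, σ)) = (Iio τ).indicator fun σ => M (τ, σ) := rfl
      rw [h1, integrable_indicator_iff measurableSet_Iio, IntegrableOn, hμ,
        Measure.restrict_restrict measurableSet_Iio, inter_comm, Ioo_inter_Iio,
        min_eq_right hτ.2.le]
      have h2 := ((intervalIntegrable_betaKernel hτ.1.le hb hc).const_mul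
        ((t - τ) ^ (a - 1))).const_mul C
      rw [intervalIntegrable_iff_integrableOn_Ioo_of_le hτ.1.le] at h2
      exact h2
    · have h2 : IntervalIntegrable (fun τ => C * beta b c *
          ((t - τ) ^ (a - 1) * (τ - s) ^ (b + c - 1))) volume s t :=
        (intervalIntegrable_betaKernel hst ha (by linarith)).const_mul _
      rw [intervalIntegrable_iff_integrableOn_Ioo_of_le hst] at h2
      refine h2.congr_fun (fun τ hτ => ?_) measurableSet_Ioo
      have h3 : ∀ σ, ‖S.indicator M (τ, σ)‖ = S.indicator (fun p => ‖M p‖) (τ, σ) := fun σ =>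
        norm_indicator_eq_indicator_norm _ _
      simp_rw [h3]
      rw [hμ, setIntegral_indicator_lt hτ]
      have h4 : ∫ σ in s..τ, ‖M (τ, σ)‖ = ∫ σ in s..τ, M (τ, σ) :=
        intervalIntegral_congr_Ioo hτ.1.le fun σ hσ => Real.norm_of_nonneg (hMnn τ hτ σ hσ)
      rw [h4]
      simp only [hM]
      rw [intervalIntegral.integral_const_mul, intervalIntegral.integral_const_mul,
        integral_betaKernel hτ.1 hb hc]
      ring
  have hfint : Integrable (S.indicator (Function.uncurry f)) (μ.prod μ) := by
    refine hMint.mono' (hf.indicator hSm).aestronglyMeasurable ?_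
    rw [hμ, Measure.prod_restrict]
    refine ae_restrict_of_forall_mem (measurableSet_Ioo.prod measurableSet_Ioo) fun p hp => ?_
    rw [norm_indicator_eq_indicator_norm]
    refine indicator_le_indicator' fun hpS => ?_
    exact hC p.1 p.2 hp.2.1 hpS hp.1.2
  have := integral_integral_swap (μ := μ) (ν := μ)
    (f := fun τ σ => S.indicator (Function.uncurry f) (τ, σ)) hfint
  rw [integral_eq_integral_Ioo hst, integral_eq_integral_Ioo hst]
  calc _ = ∫ τ, ∫ σ, S.indicator (Function.uncurry f) (τ, σ) ∂μ ∂μ :=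
        (setIntegral_congr_fun measurableSet_Ioo fun τ hτ =>
          setIntegral_indicator_lt hτ (Function.uncurry f)).symm
    _ = _ := this
    _ = _ := setIntegral_congr_fun measurableSet_Ioo fun σ hσ => hsec' σ hσ

end Bound

/-! ### The regularized Volterra operator and its fixed points -/

noncomputable section

/-- The operator on the right-hand side of the equation of the regularized fundamental matrix. -/
def volterraOp {𝔸 E : Type*} [NormedRing 𝔸] [NormedAddCommGroup E] [NormedSpace ℝ E] [Module 𝔸 E]
    (α s : ℝ) (A : ℝ → 𝔸) (f : ℝ → E) (t : ℝ) : E :=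
  ((t - s) ^ (1 - α) / Real.Gamma α) •
    ∫ τ in s..t, ((t - τ) ^ (α - 1) * (τ - s) ^ (α - 1)) • (A τ • f τ)

theorem betaKernel_nonneg {s t a b : ℝ} : ∀ τ ∈ Ioo s t, 0 ≤ (t - τ) ^ a * (τ - s) ^ b :=
  fun _ hτ => mul_nonneg (Real.rpow_nonneg (sub_nonneg.2 hτ.2.le) _)
    (Real.rpow_nonneg (sub_nonneg.2 hτ.1.le) _)

/-- The weighted beta estimate carries λ^{-α/2}, which tends to 0; bounding t - s by T makes one λ
serve all pairs s < t. -/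
theorem exists_weight {α : ℝ} (hα : α ∈ Ioo (0 : ℝ) 1) (C T : ℝ) :
    ∃ lam : ℝ, 0 < lam ∧ ∀ s t, s < t → t - s ≤ T →
      (t - s) ^ (1 - α) / Real.Gamma α * (C * ∫ τ in s..t, (t - τ) ^ (α - 1) * (τ - s) ^ (α - 1) *
        Real.exp (lam * (τ - s))) ≤ 1 / 2 * Real.exp (lam * (t - s)) := by
  have hG := Real.Gamma_pos_of_pos hα.1
  have hlim : Tendsto (fun lam : ℝ => |C| / Real.Gamma α *
      (lam ^ (-(α / 2)) * T ^ (α / 2) * beta (α / 2) α)) atTop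
      (𝓝 (|C| / Real.Gamma α * (0 * T ^ (α / 2) * beta (α / 2) α))) :=
    (((tendsto_rpow_neg_atTop (half_pos hα.1)).mul_const _).mul_const _).const_mul _
  rw [zero_mul, zero_mul, mul_zero] at hlim
  obtain ⟨lam, h1, h2⟩ := ((hlim.eventually (gt_mem_nhds (show (0 : ℝ) < 1 / 2 by norm_num))).and
    (eventually_gt_atTop 0)).exists
  refine ⟨lam, h2, fun s t hst hT => ?_⟩
  obtain ⟨-, h3⟩ := integral_betaKernel_mul_exp_le hst hα h2
  have hst' : 0 < t - s := sub_pos.2 hst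
  set J := ∫ τ in s..t, (t - τ) ^ (α - 1) * (τ - s) ^ (α - 1) * Real.exp (lam * (τ - s))
  have hJ : 0 ≤ J := intervalIntegral.integral_nonneg hst.le fun τ hτ => by
    have := sub_nonneg.2 hτ.1
    have := sub_nonneg.2 hτ.2
    positivity
  have hb := beta_pos (half_pos hα.1) hα.1
  calc (t - s) ^ (1 - α) / Real.Gamma α * (C * J)
      ≤ (t - s) ^ (1 - α) / Real.Gamma α * (|C| * J) := by gcongr; exact le_abs_self C
    _ = |C| / Real.Gamma α * ((t - s) ^ (1 - α) * J) := by ring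
    _ ≤ |C| / Real.Gamma α * (lam ^ (-(α / 2)) * (t - s) ^ (α / 2) * beta (α / 2) α *
          Real.exp (lam * (t - s))) := by gcongr
    _ ≤ |C| / Real.Gamma α * (lam ^ (-(α / 2)) * T ^ (α / 2) * beta (α / 2) α *
          Real.exp (lam * (t - s))) := by
        have := half_pos hα.1
        gcongr
    _ = |C| / Real.Gamma α * (lam ^ (-(α / 2)) * T ^ (α / 2) * beta (α / 2) α) *
          Real.exp (lam * (t - s)) := by ring
    _ ≤ _ := by gcongr

theorem volterraOp_self {𝔸 E : Type*} [NormedRing 𝔸] [NormedAddCommGroup E] [NormedSpace ℝ E]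
    [Module 𝔸 E] {α s : ℝ} {A : ℝ → 𝔸} {f : ℝ → E} : volterraOp α s A f s = 0 := by
  simp [volterraOp]

theorem volterraOp_sub {𝔸 E : Type*} [NormedRing 𝔸] [NormedAddCommGroup E] [NormedSpace ℝ E]
    [Module 𝔸 E] {α s t : ℝ} {A : ℝ → 𝔸} {f g : ℝ → E}
    (hf : IntervalIntegrable (fun τ => ((t - τ) ^ (α - 1) * (τ - s) ^ (α - 1)) • (A τ • f τ))
      volume s t)
    (hg : IntervalIntegrable (fun τ => ((t - τ) ^ (α - 1) * (τ - s) ^ (α - 1)) • (A τ • g τ))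
      volume s t) :
    volterraOp α s A (fun τ => f τ - g τ) t = volterraOp α s A f t - volterraOp α s A g t := by
  simp only [volterraOp]
  rw [← smul_sub, ← intervalIntegral.integral_sub hf hg]
  simp only [smul_sub]

/-! ### Contraction in the weighted norm and uniqueness -/

section Op

variable {𝔸 E : Type*} [NormedRing 𝔸] [NormedAddCommGroup E] [NormedSpace ℝ E] [Module 𝔸 E]
  [IsBoundedSMul 𝔸 E] {α s t C : ℝ} {A : ℝ → 𝔸} {f g : ℝ → E}

/-- The contraction estimate, kept pointwise so that iteration needs no weighted function space: one
application replaces D by D / 2. -/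
theorem norm_volterraOp_le {r lam D : ℝ} (hα : α ∈ Ioo (0 : ℝ) 1) (hA : ∀ τ, ‖A τ‖ ≤ C)
    (hlam : 0 < lam) (hw : ∀ t, s < t → t ≤ r →
      (t - s) ^ (1 - α) / Real.Gamma α * (C * ∫ τ in s..t, (t - τ) ^ (α - 1) * (τ - s) ^ (α - 1) *
        Real.exp (lam * (τ - s))) ≤ 1 / 2 * Real.exp (lam * (t - s)))
    (hst : s < t) (htr : t ≤ r) (hD : 0 ≤ D)
    (hf : ∀ τ ∈ Ioo s t, ‖f τ‖ ≤ D * Real.exp (lam * (τ - s))) :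
    ‖volterraOp α s A f t‖ ≤ D / 2 * Real.exp (lam * (t - s)) := by
  have hC : 0 ≤ C := (norm_nonneg _).trans (hA 0)
  have hG := Real.Gamma_pos_of_pos hα.1
  obtain ⟨hi, -⟩ := integral_betaKernel_mul_exp_le hst hα hlam
  have h1 : ‖∫ τ in s..t, ((t - τ) ^ (α - 1) * (τ - s) ^ (α - 1)) • (A τ • f τ)‖ ≤
      ∫ τ in s..t, (t - τ) ^ (α - 1) * (τ - s) ^ (α - 1) * (C * (D * Real.exp (lam * (τ - s)))) := by
    refine norm_integral_smul_le hst.le ?_ betaKernel_nonneg fun τ hτ => ?_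
    · convert hi.const_mul (C * D) using 2
      ring
    · exact (norm_smul_le _ _).trans (mul_le_mul (hA τ) (hf τ hτ) (norm_nonneg _) hC)
  have h2 : ∫ τ in s..t, (t - τ) ^ (α - 1) * (τ - s) ^ (α - 1) *
      (C * (D * Real.exp (lam * (τ - s)))) = D * (C * ∫ τ in s..t, (t - τ) ^ (α - 1) *
      (τ - s) ^ (α - 1) * Real.exp (lam * (τ - s))) := by
    rw [← intervalIntegral.integral_const_mul, ← intervalIntegral.integral_const_mul]
    congr 1; ext τ; ring
  rw [h2] at h1
  have hT : 0 < t - s := sub_pos.2 hst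
  have h3 : 0 ≤ (t - s) ^ (1 - α) / Real.Gamma α := by positivity
  rw [volterraOp, norm_smul, Real.norm_of_nonneg h3]
  refine (mul_le_mul_of_nonneg_left h1 h3).trans ?_
  have := mul_le_mul_of_nonneg_left (hw t hst htr) hD
  linarith

/-- A bounded solution of the homogeneous equation vanishes. -/
theorem eq_zero_of_eq_volterraOp {r M : ℝ} (hα : α ∈ Ioo (0 : ℝ) 1) (hA : ∀ τ, ‖A τ‖ ≤ C)
    (hM : ∀ t ∈ Ioc s r, ‖f t‖ ≤ M) (hf : ∀ t ∈ Ioc s r, f t = volterraOp α s A f t) :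
    ∀ t ∈ Ioc s r, f t = 0 := by
  intro t ht
  obtain ⟨lam, hl, hw⟩ := exists_weight hα C (r - s)
  have hM0 : 0 ≤ M := (norm_nonneg _).trans (hM t ht)
  have key : ∀ k : ℕ, ∀ t ∈ Ioc s r, ‖f t‖ ≤ M * (1 / 2) ^ k * Real.exp (lam * (t - s)) := by
    intro k
    induction k with
    | zero =>
      intro t ht
      rw [pow_zero, mul_one]
      refine (hM t ht).trans (le_mul_of_one_le_right hM0 (Real.one_le_exp ?_))
      exact mul_nonneg hl.le (sub_nonneg.2 ht.1.le)
    | succ k ih =>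
      intro t ht
      rw [hf t ht]
      refine (norm_volterraOp_le (D := M * (1 / 2) ^ k) hα hA hl
        (fun t h1 h2 => hw s t h1 (by linarith)) ht.1 ht.2 (by positivity)
        fun τ hτ => ih τ ⟨hτ.1, hτ.2.le.trans ht.2⟩).trans_eq ?_
      rw [pow_succ]; ring
  have hlim : Tendsto (fun k : ℕ => M * (1 / 2 : ℝ) ^ k * Real.exp (lam * (t - s))) atTop
      (𝓝 (M * 0 * Real.exp (lam * (t - s)))) :=
    ((tendsto_pow_atTop_nhds_zero_of_lt_one (by norm_num) (by norm_num)).const_mul M).mul_const _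
  rw [mul_zero, zero_mul] at hlim
  exact norm_le_zero_iff.1 (ge_of_tendsto' hlim fun k => key k t ht)

theorem intervalIntegrable_volterra {M : ℝ} (hα : 0 < α) (hA : ∀ τ, ‖A τ‖ ≤ C)
    (hAm : StronglyMeasurable A) (hst : s ≤ t)
    (hfm : AEStronglyMeasurable f (volume.restrict (Ioc s t))) (hM : ∀ τ ∈ Ioo s t, ‖f τ‖ ≤ M) :
    IntervalIntegrable (fun τ => ((t - τ) ^ (α - 1) * (τ - s) ^ (α - 1)) • (A τ • f τ))
      volume s t := by
  have hC : 0 ≤ C := (norm_nonneg _).trans (hA 0)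
  exact intervalIntegrable_smul_of_bound hst (intervalIntegrable_betaKernel hst hα hα)
    betaKernel_nonneg (hAm.aestronglyMeasurable.smul hfm) fun τ hτ =>
    (norm_smul_le _ _).trans (mul_le_mul (hA τ) (hM τ hτ) (norm_nonneg _) hC)

theorem eqOn_of_eq_const_add_volterraOp {r M N : ℝ} {v : ℝ → E} (hα : α ∈ Ioo (0 : ℝ) 1)
    (hA : ∀ τ, ‖A τ‖ ≤ C) (hAm : StronglyMeasurable A)
    (hfm : AEStronglyMeasurable f (volume.restrict (Ioc s r)))
    (hgm : AEStronglyMeasurable g (volume.restrict (Ioc s r)))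
    (hfM : ∀ t ∈ Ioc s r, ‖f t‖ ≤ M) (hgN : ∀ t ∈ Ioc s r, ‖g t‖ ≤ N)
    (hf : ∀ t ∈ Ioc s r, f t = v t + volterraOp α s A f t)
    (hg : ∀ t ∈ Ioc s r, g t = v t + volterraOp α s A g t) :
    ∀ t ∈ Ioc s r, f t = g t := by
  intro t ht
  rw [← sub_eq_zero]
  refine eq_zero_of_eq_volterraOp (f := fun t => f t - g t) (M := M + N) hα hA
    (fun t ht => (norm_sub_le _ _).trans (add_le_add (hfM t ht) (hgN t ht))) (fun t ht => ?_) t ht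
  have hsub : Ioc s t ⊆ Ioc s r := Ioc_subset_Ioc_right ht.2
  rw [volterraOp_sub
    (intervalIntegrable_volterra hα.1 hA hAm ht.1.le
      (hfm.mono_measure (Measure.restrict_mono_set _ hsub))
      fun τ hτ => hfM τ ⟨hτ.1, hτ.2.le.trans ht.2⟩)
    (intervalIntegrable_volterra hα.1 hA hAm ht.1.le
      (hgm.mono_measure (Measure.restrict_mono_set _ hsub))
      fun τ hτ => hgN τ ⟨hτ.1, hτ.2.le.trans ht.2⟩)]
  calc f t - g t = (v t + volterraOp α s A f t) - (v t + volterraOp α s A g t) := by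
        rw [← hf t ht, ← hg t ht]
    _ = _ := add_sub_add_left_eq_sub _ _ _

end Op

end

/-! ### Continuity of the regularized Volterra operator -/

noncomputable section

/-- On (s, t) the kernel decreases when its endpoint moves from t to t', so the absolute difference
of kernels integrates exactly: it is the difference of two beta integrals plus the t'-kernel's
integral over [t, t']. The latter occurs again as the new piece of the domain, whence the factor 2.
-/
theorem norm_sub_integral_betaKernel_le {E : Type*} [NormedAddCommGroup E] [NormedSpace ℝ E]
    {α s t t' N : ℝ} {ψ : ℝ → E} (hα : α ∈ Ioo (0 : ℝ) 1) (hst : s < t) (htt' : t ≤ t')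
    (hψ : AEStronglyMeasurable ψ (volume.restrict (Ioc s t'))) (hN0 : 0 ≤ N)
    (hN : ∀ τ ∈ Ioo s t', ‖ψ τ‖ ≤ N) :
    ‖(∫ τ in s..t', ((t' - τ) ^ (α - 1) * (τ - s) ^ (α - 1)) • ψ τ) -
        ∫ τ in s..t, ((t - τ) ^ (α - 1) * (τ - s) ^ (α - 1)) • ψ τ‖ ≤
      N * (beta α α * ((t - s) ^ (α + α - 1) - (t' - s) ^ (α + α - 1))
        + 2 * ((t - s) ^ (α - 1) * ((t' - t) ^ α / α))) := by
  obtain ⟨h0, h1⟩ := hα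
  have hst' : s < t' := hst.trans_le htt'
  have hk := intervalIntegrable_betaKernel (s := s) (t := t) hst.le h0 h0
  have hk' := intervalIntegrable_betaKernel (s := s) (t := t') hst'.le h0 h0
  have hsub1 : uIcc s t ⊆ uIcc s t' := by
    rw [uIcc_of_le hst.le, uIcc_of_le hst'.le]; exact Icc_subset_Icc_right htt'
  have hsub2 : uIcc t t' ⊆ uIcc s t' := by
    rw [uIcc_of_le htt', uIcc_of_le hst'.le]; exact Icc_subset_Icc_left hst.le
  have hk1 := hk'.mono_set hsub1
  have hk2 := hk'.mono_set hsub2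
  have hi := intervalIntegrable_smul_of_bound hst.le hk betaKernel_nonneg
    (hψ.mono_measure (Measure.restrict_mono_set _ (Ioc_subset_Ioc_right htt')))
    fun τ hτ => hN τ ⟨hτ.1, hτ.2.trans_le htt'⟩
  have hi' := intervalIntegrable_smul_of_bound hst'.le hk' betaKernel_nonneg hψ hN
  rw [← intervalIntegral.integral_add_adjacent_intervals (hi'.mono_set hsub1)
    (hi'.mono_set hsub2), add_sub_right_comm,
    ← intervalIntegral.integral_sub (hi'.mono_set hsub1) hi]
  have e1 : ‖∫ τ in s..t, (((t' - τ) ^ (α - 1) * (τ - s) ^ (α - 1)) • ψ τ -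
      ((t - τ) ^ (α - 1) * (τ - s) ^ (α - 1)) • ψ τ)‖ ≤
      (∫ τ in s..t, ((t - τ) ^ (α - 1) * (τ - s) ^ (α - 1) -
        (t' - τ) ^ (α - 1) * (τ - s) ^ (α - 1))) * N := by
    rw [← norm_neg, ← intervalIntegral.integral_neg]
    simp_rw [neg_sub, ← sub_smul]
    refine norm_integral_smul_le_const hst.le (hk.sub hk1) (fun τ hτ => ?_)
      fun τ hτ => hN τ ⟨hτ.1, hτ.2.trans_le htt'⟩
    rw [← sub_mul]
    refine mul_nonneg (sub_nonneg.2 ?_) (Real.rpow_nonneg (sub_nonneg.2 hτ.1.le) _)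
    exact Real.rpow_le_rpow_of_nonpos (sub_pos.2 hτ.2) (by linarith) (by linarith)
  have e2 : ‖∫ τ in t..t', ((t' - τ) ^ (α - 1) * (τ - s) ^ (α - 1)) • ψ τ‖ ≤
      (∫ τ in t..t', (t' - τ) ^ (α - 1) * (τ - s) ^ (α - 1)) * N :=
    norm_integral_smul_le_const htt' hk2
      (fun τ hτ => betaKernel_nonneg τ ⟨hst.trans hτ.1, hτ.2⟩)
      fun τ hτ => hN τ ⟨hst.trans hτ.1, hτ.2⟩
  have e3 : ∫ τ in t..t', (t' - τ) ^ (α - 1) * (τ - s) ^ (α - 1) ≤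
      (t - s) ^ (α - 1) * ((t' - t) ^ α / α) := by
    have : (t' - t) ^ α / α = ∫ τ in t..t', (t' - τ) ^ (α - 1) := by
      rw [integral_leftKernel h0, sub_self, Real.zero_rpow h0.ne', sub_zero]
    rw [this, ← intervalIntegral.integral_const_mul]
    refine intervalIntegral.integral_mono_on_of_le_Ioo htt' hk2
      ((intervalIntegrable_leftKernel t' h0).const_mul _) fun τ hτ => ?_
    rw [mul_comm]
    refine mul_le_mul_of_nonneg_right ?_ (Real.rpow_nonneg (sub_nonneg.2 hτ.2.le) _)
    exact Real.rpow_le_rpow_of_nonpos (sub_pos.2 hst) (by linarith [hτ.1]) (by linarith)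
  have e4 := intervalIntegral.integral_add_adjacent_intervals hk1 hk2
  rw [integral_betaKernel hst' h0 h0] at e4
  rw [intervalIntegral.integral_sub hk hk1, integral_betaKernel hst h0 h0] at e1
  refine (norm_add_le _ _).trans ((add_le_add e1 e2).trans ?_)
  rw [← add_mul, mul_comm]
  refine mul_le_mul_of_nonneg_left ?_ hN0
  linarith

theorem continuousOn_integral_betaKernel {E : Type*} [NormedAddCommGroup E] [NormedSpace ℝ E]
    {α s r N : ℝ} {ψ : ℝ → E} (hα : α ∈ Ioo (0 : ℝ) 1)
    (hψ : AEStronglyMeasurable ψ (volume.restrict (Ioc s r)))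
    (hN : ∀ τ ∈ Ioc s r, ‖ψ τ‖ ≤ N) :
    ContinuousOn (fun t => ∫ τ in s..t, ((t - τ) ^ (α - 1) * (τ - s) ^ (α - 1)) • ψ τ)
      (Ioc s r) := by
  intro t₁ ht₁
  have hN0 : 0 ≤ N := (norm_nonneg _).trans (hN t₁ ht₁)
  have hpos : 0 < t₁ - s := sub_pos.2 ht₁.1
  rw [ContinuousWithinAt, tendsto_iff_norm_sub_tendsto_zero]
  -- Using min and max gives one majorant for t on either side of t₁; it vanishes at t = t₁.
  have hcont : ContinuousAt (fun t => N * (beta α α * ((min t t₁ - s) ^ (α + α - 1) -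
      (max t t₁ - s) ^ (α + α - 1)) + 2 * ((min t t₁ - s) ^ (α - 1) *
        ((max t t₁ - min t t₁) ^ α / α)))) t₁ := by
    have hmin : ContinuousAt (fun t => min t t₁ - s) t₁ := by fun_prop
    have hmax : ContinuousAt (fun t => max t t₁ - s) t₁ := by fun_prop
    have hmm : ContinuousAt (fun t => max t t₁ - min t t₁) t₁ := by fun_prop
    have h1 : min t₁ t₁ - s ≠ 0 := by rw [min_self]; exact hpos.ne'
    have h2 : max t₁ t₁ - s ≠ 0 := by rw [max_self]; exact hpos.ne'
    exact continuousAt_const.mul ((continuousAt_const.mul ((hmin.rpow_const (Or.inl h1)).sub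
      (hmax.rpow_const (Or.inl h2)))).add (continuousAt_const.mul
      ((hmin.rpow_const (Or.inl h1)).mul ((hmm.rpow_const (Or.inr hα.1.le)).div_const _))))
  have hlim := hcont.tendsto
  simp only [min_self, max_self, sub_self, Real.zero_rpow hα.1.ne', zero_div, mul_zero,
    add_zero] at hlim
  refine squeeze_zero' (Eventually.of_forall fun _ => norm_nonneg _) ?_
    (hlim.mono_left (nhdsWithin_le_nhds (s := Ioc s r)))
  filter_upwards [self_mem_nhdsWithin] with t ht
  rcases le_total t t₁ with h | h
  · rw [min_eq_left h, max_eq_right h, norm_sub_rev]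
    exact norm_sub_integral_betaKernel_le hα ht.1 h
      (hψ.mono_measure (Measure.restrict_mono_set _ (Ioc_subset_Ioc_right ht₁.2))) hN0
      fun τ hτ => hN τ ⟨hτ.1, hτ.2.le.trans ht₁.2⟩
  · rw [min_eq_right h, max_eq_left h]
    exact norm_sub_integral_betaKernel_le hα ht₁.1 h
      (hψ.mono_measure (Measure.restrict_mono_set _ (Ioc_subset_Ioc_right ht.2))) hN0
      fun τ hτ => hN τ ⟨hτ.1, hτ.2.le.trans ht.2⟩

/-- Only the left endpoint needs care: there the beta integral may be singular of order 2α - 1, but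
the prefactor (t-s)^{1-α} turns this into (t-s)^α, which tends to 0. -/
theorem continuousOn_volterraOp {𝔸 E : Type*} [NormedRing 𝔸] [NormedAddCommGroup E]
    [NormedSpace ℝ E] [Module 𝔸 E] [IsBoundedSMul 𝔸 E] {α s r C M : ℝ} {A : ℝ → 𝔸} {f : ℝ → E}
    (hα : α ∈ Ioo (0 : ℝ) 1) (hA : ∀ τ, ‖A τ‖ ≤ C) (hAm : StronglyMeasurable A)
    (hfm : AEStronglyMeasurable f (volume.restrict (Ioc s r))) (hM : ∀ t ∈ Ioc s r, ‖f t‖ ≤ M) :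
    ContinuousOn (volterraOp α s A f) (Icc s r) := by
  have hC : 0 ≤ C := (norm_nonneg _).trans (hA 0)
  have hψ : ∀ τ ∈ Ioc s r, ‖A τ • f τ‖ ≤ C * M := fun τ hτ =>
    (norm_smul_le _ _).trans (mul_le_mul (hA τ) (hM τ hτ) (norm_nonneg _) hC)
  have hψm : AEStronglyMeasurable (fun τ => A τ • f τ) (volume.restrict (Ioc s r)) :=
    hAm.aestronglyMeasurable.smul hfm
  have hα1 : 0 < 1 - α := sub_pos.2 hα.2
  intro t₁ ht₁
  rcases ht₁.1.eq_or_lt with rfl | hlt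
  · rw [ContinuousWithinAt, volterraOp_self]
    have hlim : Tendsto (fun t => beta α α * (C * M) / Real.Gamma α * (t - s) ^ α) (𝓝[Icc s r] s)
        (𝓝 (beta α α * (C * M) / Real.Gamma α * (s - s) ^ α)) := by
      refine Tendsto.mono_left (ContinuousAt.tendsto ?_) nhdsWithin_le_nhds
      exact continuousAt_const.mul (ContinuousAt.rpow_const (by fun_prop) (Or.inr hα.1.le))
    rw [sub_self, Real.zero_rpow hα.1.ne', mul_zero] at hlim
    refine squeeze_zero_norm' ?_ hlim
    filter_upwards [self_mem_nhdsWithin] with t ht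
    rcases ht.1.eq_or_lt with rfl | hst
    · rw [volterraOp_self, sub_self, Real.zero_rpow hα.1.ne', norm_zero, mul_zero]
    have hT : 0 < t - s := sub_pos.2 hst
    have hG := Real.Gamma_pos_of_pos hα.1
    have h3 : 0 ≤ (t - s) ^ (1 - α) / Real.Gamma α := by positivity
    rw [volterraOp, norm_smul, Real.norm_of_nonneg h3]
    refine (mul_le_mul_of_nonneg_left (norm_integral_smul_le_const hst.le
      (intervalIntegrable_betaKernel hst.le hα.1 hα.1) betaKernel_nonneg
      fun τ hτ => hψ τ ⟨hτ.1, hτ.2.le.trans ht.2⟩) h3).trans_eq ?_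
    rw [integral_betaKernel hst hα.1 hα.1]
    have : (t - s) ^ α = (t - s) ^ (1 - α) * (t - s) ^ (α + α - 1) := by
      rw [← Real.rpow_add hT]; congr 1; ring
    rw [this]; ring
  · have h1 : ContinuousWithinAt (volterraOp α s A f) (Ioc s r) t₁ := by
      refine ContinuousWithinAt.smul ?_
        (continuousOn_integral_betaKernel hα hψm hψ t₁ ⟨hlt, ht₁.2⟩)
      exact (ContinuousAt.div_const (ContinuousAt.rpow_const (by fun_prop) (Or.inr hα1.le))
        _).continuousWithinAt
    refine h1.mono_of_mem_nhdsWithin ?_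
    filter_upwards [self_mem_nhdsWithin, nhdsWithin_le_nhds (Ioi_mem_nhds hlt)] with x hx hx'
    exact ⟨hx', hx.2⟩

/-! ### The resolvent -/

section Resolvent

variable {𝔸 : Type*} [NormedRing 𝔸] [NormedAlgebra ℝ 𝔸]

/-- The terms of the Neumann series of the regularized fundamental matrix. -/
def resolventTerm (α : ℝ) (A : ℝ → 𝔸) : ℕ → ℝ → ℝ → 𝔸
  | 0 => fun _ _ => (1 / Real.Gamma α) • 1
  | k + 1 => fun t s => volterraOp α s A (fun τ => resolventTerm α A k τ s) t

variable {α C : ℝ} {A : ℝ → 𝔸}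

theorem stronglyMeasurable_resolventTerm (hAm : StronglyMeasurable A) (k : ℕ) :
    StronglyMeasurable (Function.uncurry (resolventTerm α A k)) := by
  induction k with
  | zero => exact stronglyMeasurable_const
  | succ k ih =>
    have h1 : Measurable fun p : ℝ × ℝ => (p.1 - p.2) ^ (1 - α) / Real.Gamma α :=
      (Measurable.pow_const (by fun_prop) _).div_const _
    refine h1.stronglyMeasurable.smul ?_
    refine stronglyMeasurable_intervalIntegral (f := fun (p : ℝ × ℝ) τ =>
      ((p.1 - τ) ^ (α - 1) * (τ - p.2) ^ (α - 1)) • (A τ • resolventTerm α A k τ p.2)) ?_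
      measurable_snd measurable_fst
    have h2 : Measurable fun q : (ℝ × ℝ) × ℝ =>
        (q.1.1 - q.2) ^ (α - 1) * (q.2 - q.1.2) ^ (α - 1) :=
      (Measurable.pow_const (by fun_prop) _).mul (Measurable.pow_const (by fun_prop) _)
    exact h2.stronglyMeasurable.smul ((hAm.comp_measurable measurable_snd).smul
      (ih.comp_measurable (measurable_snd.prodMk (measurable_snd.comp measurable_fst))))

theorem norm_resolventTerm_le {T lam : ℝ} (hα : α ∈ Ioo (0 : ℝ) 1) (hA : ∀ τ, ‖A τ‖ ≤ C)
    (hlam : 0 < lam) (hw : ∀ s t, s < t → t - s ≤ T →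
      (t - s) ^ (1 - α) / Real.Gamma α * (C * ∫ τ in s..t, (t - τ) ^ (α - 1) * (τ - s) ^ (α - 1) *
        Real.exp (lam * (τ - s))) ≤ 1 / 2 * Real.exp (lam * (t - s))) (k : ℕ) {s t : ℝ}
    (hst : s ≤ t) (hT : t - s ≤ T) :
    ‖resolventTerm α A k t s‖ ≤
      ‖(1 / Real.Gamma α) • (1 : 𝔸)‖ * (1 / 2) ^ k * Real.exp (lam * (t - s)) := by
  induction k generalizing t with
  | zero =>
    rw [pow_zero, mul_one]
    exact le_mul_of_one_le_right (norm_nonneg _)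
      (Real.one_le_exp (mul_nonneg hlam.le (sub_nonneg.2 hst)))
  | succ k ih =>
    rcases hst.eq_or_lt with rfl | hlt
    · simp only [resolventTerm, volterraOp_self, norm_zero]
      positivity
    refine (norm_volterraOp_le (r := t) (D := ‖(1 / Real.Gamma α) • (1 : 𝔸)‖ * (1 / 2) ^ k) hα hA
      hlam (fun t' h1 h2 => hw s t' h1 (by linarith)) hlt le_rfl (by positivity)
      fun τ hτ => ih hτ.1.le (by linarith [hτ.2])).trans_eq ?_
    rw [pow_succ]; ring

/-- The Neumann series converges geometrically by the weighted contraction. Summing measurable terms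
gives joint measurability in (t, s), which solving separately for each s would not. -/
theorem exists_resolvent [CompleteSpace 𝔸] (hα : α ∈ Ioo (0 : ℝ) 1) (hA : ∀ τ, ‖A τ‖ ≤ C)
    (hAm : StronglyMeasurable A) (T : ℝ) : ∃ (R : ℝ → ℝ → 𝔸) (D : ℝ),
      StronglyMeasurable (Function.uncurry R) ∧ 0 ≤ D ∧ (∀ t s, ‖R t s‖ ≤ D) ∧
      ∀ s t, s ≤ t → t - s ≤ T →
        R t s = (1 / Real.Gamma α) • 1 + volterraOp α s A (fun τ => R τ s) t := by
  have hC : 0 ≤ C := (norm_nonneg _).trans (hA 0)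
  obtain ⟨lam, hlam, hw⟩ := exists_weight hα C T
  set G := resolventTerm α A with hG
  set N : ℝ := ‖(1 / Real.Gamma α) • (1 : 𝔸)‖ * Real.exp (lam * T) with hN
  have hN0 : 0 ≤ N := by positivity
  have hbd : ∀ k {s t : ℝ}, s ≤ t → t - s ≤ T → ‖G k t s‖ ≤ N * (1 / 2) ^ k := by
    intro k s t hst hT
    refine (norm_resolventTerm_le hα hA hlam hw k hst hT).trans ?_
    rw [hN, mul_right_comm]
    gcongr
  have hsum2 : HasSum (fun k : ℕ => N * (1 / 2 : ℝ) ^ k) (N * 2) := hasSum_geometric_two.mul_left N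
  have hsum : ∀ {s t : ℝ}, s ≤ t → t - s ≤ T → HasSum (fun k => G k t s) (∑' k, G k t s) :=
    fun hst hT => (Summable.of_norm_bounded hsum2.summable fun k => hbd k hst hT).hasSum
  set S : Set (ℝ × ℝ) := {p | p.2 ≤ p.1 ∧ p.1 - p.2 ≤ T} with hS
  have hSm : MeasurableSet S :=
    (measurableSet_le measurable_snd measurable_fst).inter
      (measurableSet_le (measurable_fst.sub measurable_snd) measurable_const)
  -- Zero outside the region of convergence, so that the bound on R holds for all arguments.
  set R : ℝ → ℝ → 𝔸 := fun t s => S.indicator (fun p => ∑' k, G k p.1 p.2) (t, s) with hR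
  have hReq : ∀ {s t : ℝ}, s ≤ t → t - s ≤ T → R t s = ∑' k, G k t s := fun {s t} hst hT =>
    indicator_of_mem (show (t, s) ∈ S from ⟨hst, hT⟩) _
  refine ⟨R, N * 2, ?_, by positivity, ?_, ?_⟩
  · refine stronglyMeasurable_of_tendsto atTop
      (f := fun n p => S.indicator (fun p => ∑ k ∈ Finset.range n, G k p.1 p.2) p) (fun n => ?_) ?_
    · exact (Finset.stronglyMeasurable_fun_sum _ fun k _ =>
        stronglyMeasurable_resolventTerm hAm k).indicator hSm
    · rw [tendsto_pi_nhds]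
      intro p
      by_cases hp : p ∈ S
      · simp only [indicator_of_mem hp]
        have : Function.uncurry R p = ∑' k, G k p.1 p.2 := hReq hp.1 hp.2
        rw [this]
        exact (hsum hp.1 hp.2).tendsto_sum_nat
      · have : Function.uncurry R p = 0 :=
          indicator_of_notMem (f := fun p : ℝ × ℝ => ∑' k, G k p.1 p.2) hp
        simp only [indicator_of_notMem hp, this]
        exact tendsto_const_nhds
  · intro t s
    by_cases hp : (t, s) ∈ S
    · rw [hReq hp.1 hp.2]
      exact tsum_of_norm_bounded hsum2 fun k => hbd k hp.1 hp.2
    · have : R t s = 0 := indicator_of_notMem hp _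
      rw [this, norm_zero]; positivity
  · intro s t hst hT
    have hk := intervalIntegrable_betaKernel hst hα.1 hα.1
    have hint : HasSum (fun k => ∫ τ in s..t, ((t - τ) ^ (α - 1) * (τ - s) ^ (α - 1)) •
        (A τ • G k τ s)) (∫ τ in s..t, ((t - τ) ^ (α - 1) * (τ - s) ^ (α - 1)) • (A τ • R τ s)) := by
      refine intervalIntegral.hasSum_integral_of_dominated_convergence
        (fun k τ => ((t - τ) ^ (α - 1) * (τ - s) ^ (α - 1)) * (C * (N * (1 / 2 : ℝ) ^ k)))
        (fun k => ?_) (fun k => ?_) ?_ ?_ ?_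
      · rw [uIoc_of_le hst]
        refine hk.1.aestronglyMeasurable.smul (hAm.smul ?_).aestronglyMeasurable
        exact (stronglyMeasurable_resolventTerm hAm k).comp_measurable
          (measurable_id.prodMk measurable_const)
      · refine Eventually.of_forall fun τ hτ => ?_
        rw [uIoc_of_le hst] at hτ
        have h0 : 0 ≤ (t - τ) ^ (α - 1) * (τ - s) ^ (α - 1) :=
          mul_nonneg (Real.rpow_nonneg (sub_nonneg.2 hτ.2) _)
            (Real.rpow_nonneg (sub_nonneg.2 hτ.1.le) _)
        rw [norm_smul, Real.norm_of_nonneg h0]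
        refine mul_le_mul_of_nonneg_left ((norm_smul_le _ _).trans ?_) h0
        exact mul_le_mul (hA τ) (hbd k hτ.1.le (by linarith [hτ.2])) (norm_nonneg _) hC
      · exact Eventually.of_forall fun τ _ => (hsum2.summable.mul_left C).mul_left _
      · simp_rw [tsum_mul_left]
        exact hk.mul_const _
      · refine Eventually.of_forall fun τ hτ => ?_
        rw [uIoc_of_le hst] at hτ
        have hT' : τ - s ≤ T := by linarith [hτ.2]
        rw [hReq hτ.1.le hT']
        exact ((hsum hτ.1.le hT').const_smul (A τ)).const_smul _
    have h2 : HasSum (fun k => G (k + 1) t s) (volterraOp α s A (fun τ => R τ s) t) :=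
      hint.const_smul _
    rw [hReq hst hT]
    -- Integrating the series termwise shifts its index by one; the missing zeroth term is the
    -- constant of the equation.
    have h3 := (hasSum_nat_add_iff' 1).2 (hsum hst hT)
    rw [Finset.sum_range_one] at h3
    rw [h2.unique h3]
    exact (add_sub_cancel _ _).symm

end Resolvent

end

/-! ### Fractional integrals and the Caputo derivative -/

section Fractional

variable {E : Type*} [NormedAddCommGroup E] [NormedSpace ℝ E] {φ : ℝ → E} {α C : ℝ}

theorem leftKernel_nonneg {s t a : ℝ} : ∀ τ ∈ Ioo s t, 0 ≤ (t - τ) ^ a :=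
  fun _ hτ => Real.rpow_nonneg (sub_nonneg.2 hτ.2.le) _

theorem stronglyMeasurable_rlIntegral (hφ : StronglyMeasurable φ) (β a : ℝ) :
    StronglyMeasurable (rlIntegral β a φ) := by
  refine StronglyMeasurable.const_smul (stronglyMeasurable_intervalIntegral
    (f := fun t τ => (t - τ) ^ (β - 1) • φ τ) ?_ measurable_const measurable_id) _
  have h : Measurable fun p : ℝ × ℝ => (p.1 - p.2) ^ (β - 1) := Measurable.pow_const (by fun_prop) _
  exact h.stronglyMeasurable.smul (hφ.comp_measurable measurable_snd)

theorem norm_rlIntegral_le {β a t : ℝ} (hβ : 0 < β) (hat : a ≤ t) (hC : ∀ τ ∈ Ioo a t, ‖φ τ‖ ≤ C) :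
    ‖rlIntegral β a φ t‖ ≤ 1 / Real.Gamma β * ((t - a) ^ β / β * C) := by
  have hG := Real.Gamma_pos_of_pos hβ
  rw [rlIntegral, norm_smul, Real.norm_of_nonneg (by positivity)]
  refine mul_le_mul_of_nonneg_left ?_ (by positivity)
  refine (norm_integral_smul_le_const hat (intervalIntegrable_leftKernel t hβ) leftKernel_nonneg
    hC).trans_eq ?_
  rw [integral_leftKernel hβ, sub_self, Real.zero_rpow hβ.ne', sub_zero]

theorem norm_rlIntegral_le_of_le {β a t r : ℝ} (hβ : 0 < β) (hat : a ≤ t) (htr : t ≤ r)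
    (hC0 : 0 ≤ C) (hC : ∀ τ, ‖φ τ‖ ≤ C) :
    ‖rlIntegral β a φ t‖ ≤ 1 / Real.Gamma β * ((r - a) ^ β / β * C) := by
  have hG := Real.Gamma_pos_of_pos hβ
  refine (norm_rlIntegral_le hβ hat fun τ _ => hC τ).trans ?_
  have : 0 ≤ t - a := sub_nonneg.2 hat
  gcongr

theorem beta_one_sub (α : ℝ) :
    beta (1 - α) α = Real.Gamma (1 - α) * Real.Gamma α := by
  rw [beta, sub_add_cancel, Real.Gamma_one, div_one]

/-- After Fubini the inner integral is B(1-α, α) (t-σ)^0, independent of σ, and B(1-α, α) = Γ(1-α)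
Γ(α) cancels the normalizations. -/
theorem rlIntegral_rlIntegral [CompleteSpace E] {a t : ℝ} (hα : α ∈ Ioo (0 : ℝ) 1)
    (hφ : StronglyMeasurable φ)
    (hC : ∀ τ, ‖φ τ‖ ≤ C) (hat : a ≤ t) :
    rlIntegral (1 - α) a (rlIntegral α a φ) t = ∫ τ in a..t, φ τ := by
  have hα1 : 0 < 1 - α := sub_pos.2 hα.2
  have hC0 : 0 ≤ C := (norm_nonneg _).trans (hC 0)
  have hk : Measurable fun p : ℝ × ℝ =>
      (t - p.1) ^ (1 - α - 1) * (p.1 - p.2) ^ (α - 1) :=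
    (Measurable.pow_const (by fun_prop) _).mul (Measurable.pow_const (by fun_prop) _)
  have hswap := integral_triangle_swap (s := a) (t := t) (c := 1) (C := C) hat hα1 hα.1
    zero_lt_one hC0
    (f := fun τ σ => ((t - τ) ^ (1 - α - 1) * (τ - σ) ^ (α - 1)) • φ σ)
    (hk.stronglyMeasurable.smul (hφ.comp_measurable measurable_snd))
    (fun τ σ h1 h2 h3 => by
      have h4 : 0 ≤ (t - τ) ^ (1 - α - 1) * (τ - σ) ^ (α - 1) :=
        mul_nonneg (Real.rpow_nonneg (sub_nonneg.2 h3.le) _)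
          (Real.rpow_nonneg (sub_nonneg.2 h2.le) _)
      rw [norm_smul, Real.norm_of_nonneg h4, sub_self, Real.rpow_zero, mul_one, mul_comm C]
      exact mul_le_mul_of_nonneg_left (hC σ) h4)
  have h1 : ∀ τ, (t - τ) ^ (1 - α - 1) • rlIntegral α a φ τ = (1 / Real.Gamma α) •
      ∫ σ in a..τ, ((t - τ) ^ (1 - α - 1) * (τ - σ) ^ (α - 1)) • φ σ := fun τ => by
    rw [rlIntegral, smul_comm, ← intervalIntegral.integral_smul]
    simp_rw [smul_smul]
  rw [rlIntegral]
  simp_rw [h1]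
  rw [intervalIntegral.integral_smul, hswap, smul_smul]
  have h2 : ∫ σ in a..t, ∫ τ in σ..t, ((t - τ) ^ (1 - α - 1) * (τ - σ) ^ (α - 1)) • φ σ
      = ∫ σ in a..t, beta (1 - α) α • φ σ := by
    refine intervalIntegral_congr_Ioo hat fun σ hσ => ?_
    rw [intervalIntegral.integral_smul_const, integral_betaKernel hσ.2 hα1 hα.1]
    simp
  rw [h2, intervalIntegral.integral_smul, smul_smul, beta_one_sub α]
  have hG1 := (Real.Gamma_pos_of_pos hα1).ne'
  have hG2 := (Real.Gamma_pos_of_pos hα.1).ne'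
  rw [show 1 / Real.Gamma (1 - α) * (1 / Real.Gamma α) *
    (Real.Gamma (1 - α) * Real.Gamma α) = 1 by field_simp, one_smul]

/-- For almost every `t`, the Caputo derivative of `x(a) + I^α φ` at `t` is `φ t`. -/
theorem ae_hasCaputoDerivAt_iff [CompleteSpace E] {a b : ℝ} {x : ℝ → E} (hα : α ∈ Ioo (0 : ℝ) 1)
    (hφ : StronglyMeasurable φ) (hC : ∀ τ, ‖φ τ‖ ≤ C)
    (hx : ∀ t ∈ Icc a b, x t = x a + rlIntegral α a φ t) :
    ∀ᵐ t ∂(volume.restrict (Icc a b)), ∀ v, HasCaputoDerivAt α a x v t ↔ v = φ t := by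
  have hloc : LocallyIntegrable φ volume :=
    (memLp_top_of_bound hφ.aestronglyMeasurable C (Eventually.of_forall hC)).locallyIntegrable
      le_top
  -- Discarding the endpoints gives every remaining t a neighbourhood inside the interval, where the
  -- two functions to be differentiated agree.
  rw [← restrict_Ioo_eq_restrict_Icc, ae_restrict_iff' measurableSet_Ioo]
  filter_upwards [LocallyIntegrable.ae_hasDerivAt_integral hloc] with t ht htab v
  have heq : rlIntegral (1 - α) a (fun τ => x τ - x a) =ᶠ[𝓝 t] fun t => ∫ τ in a..t, φ τ := by
    filter_upwards [Ioo_mem_nhds htab.1 htab.2] with y hy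
    rw [← rlIntegral_rlIntegral hα hφ hC hy.1.le, rlIntegral, rlIntegral]
    congr 1
    refine intervalIntegral_congr_Ioo hy.1.le fun τ hτ => ?_
    rw [hx τ ⟨hτ.1.le, (hτ.2.trans hy.2).le⟩, add_sub_cancel_left]
  rw [HasCaputoDerivAt, heq.hasDerivAt_iff]
  exact ⟨fun h => h.unique (ht a), fun h => h ▸ ht a⟩

/-! ### The memory term -/

/-- First Fubini step for the memory identity, on a rectangle. The kernel is singular at the corner
τ = ξ = s, but its τ-integral grows only like (s-ξ)^{-α}, which is integrable because α < 1. -/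
theorem integral_rpow_smul_swap [CompleteSpace E] {a s t U : ℝ} {u : ℝ → E} (has : a ≤ s) (hst : s < t)
    (hα : α ∈ Ioo (0 : ℝ) 1) (hu : StronglyMeasurable u) (hU : ∀ ξ ∈ Ioo a s, ‖u ξ‖ ≤ U) :
    ∫ τ in s..t, (t - τ) ^ (α - 1) • ∫ ξ in a..s, (τ - ξ) ^ (-1 - α) • u ξ =
      ((t - s) ^ α / α) • ∫ ξ in a..s, (s - ξ) ^ (-α) • ((t - ξ)⁻¹ • u ξ) := by
  have hkm : Measurable fun p : ℝ × ℝ => (t - p.1) ^ (α - 1) * (p.1 - p.2) ^ (-1 - α) :=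
    (Measurable.pow_const (by fun_prop) _).mul (Measurable.pow_const (by fun_prop) _)
  have hnn : ∀ τ ∈ Ioo s t, ∀ ξ ∈ Ioo a s, 0 ≤ (t - τ) ^ (α - 1) * (τ - ξ) ^ (-1 - α) :=
    fun τ hτ ξ hξ => mul_nonneg (Real.rpow_nonneg (sub_nonneg.2 hτ.2.le) _)
      (Real.rpow_nonneg (sub_nonneg.2 (hξ.2.trans hτ.1).le) _)
  have hfib : ∀ ξ ∈ Ioo a s, ∫ τ in s..t, (t - τ) ^ (α - 1) * (τ - ξ) ^ (-1 - α) =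
      (t - s) ^ α / α * ((s - ξ) ^ (-α) * (t - ξ)⁻¹) := fun ξ hξ => by
    rw [(integral_rpow_div_rpow hξ.2 hst hα.1).2, Real.rpow_neg (sub_nonneg.2 hξ.2.le)]
    have h1 : 0 < s - ξ := sub_pos.2 hξ.2
    have h2 : 0 < t - ξ := sub_pos.2 (hξ.2.trans hst)
    have := Real.rpow_pos_of_pos h1 α
    have := hα.1
    field_simp
  have hfibint : ∀ ξ ∈ Ioo a s, IntegrableOn (fun τ => (t - τ) ^ (α - 1) * (τ - ξ) ^ (-1 - α))
      (Ioo s t) := fun ξ hξ =>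
    (intervalIntegrable_iff_integrableOn_Ioo_of_le hst.le).1
      (integral_rpow_div_rpow hξ.2 hst hα.1).1
  have hint : Integrable (fun p : ℝ × ℝ => (t - p.1) ^ (α - 1) * (p.1 - p.2) ^ (-1 - α))
      ((volume.restrict (Ioo s t)).prod (volume.restrict (Ioo a s))) := by
    rw [integrable_prod_iff' hkm.aestronglyMeasurable]
    refine ⟨ae_restrict_of_forall_mem measurableSet_Ioo hfibint, ?_⟩
    have h1 : IntervalIntegrable (fun ξ => (s - ξ) ^ (1 - α - 1)) volume a s :=
      intervalIntegrable_leftKernel s (sub_pos.2 hα.2)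
    have h2 : IntervalIntegrable (fun ξ => (t - s) ^ α / α * ((s - ξ) ^ (1 - α - 1) * (t - ξ)⁻¹))
        volume a s := by
      refine (h1.mul_continuousOn (ContinuousOn.inv₀ (by fun_prop) fun x hx => ?_)).const_mul _
      rw [uIcc_of_le has] at hx
      exact (sub_pos.2 (hx.2.trans_lt hst)).ne'
    refine ((intervalIntegrable_iff_integrableOn_Ioo_of_le has).1 h2).congr_fun (fun ξ hξ => ?_)
      measurableSet_Ioo
    have h3 : ∫ τ in Ioo s t, ‖(t - τ) ^ (α - 1) * (τ - ξ) ^ (-1 - α)‖ =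
        ∫ τ in Ioo s t, (t - τ) ^ (α - 1) * (τ - ξ) ^ (-1 - α) :=
      setIntegral_congr_fun measurableSet_Ioo fun τ hτ => Real.norm_of_nonneg (hnn τ hτ ξ hξ)
    beta_reduce
    rw [h3, ← integral_eq_integral_Ioo hst.le, hfib ξ hξ, show 1 - α - 1 = -α by ring]
  have hintf : Integrable (Function.uncurry fun τ ξ : ℝ =>
      ((t - τ) ^ (α - 1) * (τ - ξ) ^ (-1 - α)) • u ξ)
      ((volume.restrict (Ioo s t)).prod (volume.restrict (Ioo a s))) := by
    refine (hint.const_mul U).mono' (hkm.stronglyMeasurable.smul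
      (hu.comp_measurable measurable_snd)).aestronglyMeasurable ?_
    rw [Measure.prod_restrict]
    refine ae_restrict_of_forall_mem (measurableSet_Ioo.prod measurableSet_Ioo) fun p hp => ?_
    have h4 := hnn p.1 hp.1 p.2 hp.2
    rw [Function.uncurry, norm_smul, Real.norm_of_nonneg h4, mul_comm U]
    exact mul_le_mul_of_nonneg_left (hU p.2 hp.2) h4
  have hswap := integral_integral_swap hintf
  simp_rw [integral_eq_integral_Ioo hst.le, integral_eq_integral_Ioo has, ← integral_smul,
    smul_smul]
  rw [hswap]
  refine setIntegral_congr_fun measurableSet_Ioo fun ξ hξ => ?_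
  rw [integral_smul_const, ← integral_eq_integral_Ioo hst.le, hfib ξ hξ]

/-- The memory term `h` of `u = I^α φ` beyond `s` reproduces the tail of the fractional integral. -/
theorem integral_memory [CompleteSpace E] {a s t : ℝ} (has : a ≤ s) (hst : s < t)
    (hα : α ∈ Ioo (0 : ℝ) 1)
    (hφ : StronglyMeasurable φ) (hC : ∀ τ, ‖φ τ‖ ≤ C) :
    ∫ τ in s..t, (t - τ) ^ (α - 1) • ((α / Real.Gamma (1 - α)) •
        ∫ ξ in a..s, (τ - ξ) ^ (-1 - α) • rlIntegral α a φ ξ) =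
      ∫ η in a..s, (t - η) ^ (α - 1) • φ η := by
  have hα1 : 0 < 1 - α := sub_pos.2 hα.2
  have hC0 : 0 ≤ C := (norm_nonneg _).trans (hC 0)
  have hG1 := (Real.Gamma_pos_of_pos hα1)
  have hG2 := (Real.Gamma_pos_of_pos hα.1)
  have hts : 0 < t - s := sub_pos.2 hst
  have hkm : Measurable fun p : ℝ × ℝ =>
      (s - p.1) ^ (-α) * (p.1 - p.2) ^ (α - 1) * (t - p.1)⁻¹ :=
    ((Measurable.pow_const (by fun_prop) _).mul (Measurable.pow_const (by fun_prop) _)).mul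
      (by fun_prop)
  -- Second Fubini step, after expanding I^α φ. The extra factor (t-ξ)⁻¹ is harmless since ξ < s <
  -- t, so it is absorbed into the constant.
  have hswap := integral_triangle_swap (s := a) (t := s) (a := 1 - α) (b := α) (c := 1)
    (C := C * (t - s)⁻¹) has hα1 hα.1 zero_lt_one (by positivity)
    (f := fun ξ η => ((s - ξ) ^ (-α) * (ξ - η) ^ (α - 1) * (t - ξ)⁻¹) • φ η)
    (hkm.stronglyMeasurable.smul (hφ.comp_measurable measurable_snd))
    (fun ξ η h1 h2 h3 => by
      have h4 : 0 ≤ (s - ξ) ^ (-α) * (ξ - η) ^ (α - 1) :=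
        mul_nonneg (Real.rpow_nonneg (sub_nonneg.2 h3.le) _)
          (Real.rpow_nonneg (sub_nonneg.2 h2.le) _)
      have h5 : 0 ≤ (t - ξ)⁻¹ := inv_nonneg.2 (sub_nonneg.2 (h3.trans hst).le)
      have h6 : (t - ξ)⁻¹ ≤ (t - s)⁻¹ := inv_anti₀ hts (by linarith)
      rw [norm_smul, Real.norm_of_nonneg (mul_nonneg h4 h5), sub_self, Real.rpow_zero, mul_one,
        show 1 - α - 1 = -α by ring]
      calc _ ≤ (s - ξ) ^ (-α) * (ξ - η) ^ (α - 1) * (t - s)⁻¹ * C :=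
            mul_le_mul (mul_le_mul_of_nonneg_left h6 h4) (hC η) (norm_nonneg _) (by positivity)
        _ = _ := by ring)
  simp_rw [smul_comm _ (α / Real.Gamma (1 - α))]
  rw [intervalIntegral.integral_smul, integral_rpow_smul_swap has hst hα
    (stronglyMeasurable_rlIntegral hφ α a)
    (fun ξ hξ => norm_rlIntegral_le_of_le hα.1 hξ.1.le hξ.2.le hC0 hC)]
  have h1 : ∀ ξ, (s - ξ) ^ (-α) • ((t - ξ)⁻¹ • rlIntegral α a φ ξ) = (1 / Real.Gamma α) •
      ∫ η in a..ξ, ((s - ξ) ^ (-α) * (ξ - η) ^ (α - 1) * (t - ξ)⁻¹) • φ η := fun ξ => by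
    rw [rlIntegral, smul_comm _ (1 / Real.Gamma α), smul_comm _ (1 / Real.Gamma α),
      smul_smul ((s - ξ) ^ (-α)), ← intervalIntegral.integral_smul]
    congr 1
    refine intervalIntegral.integral_congr fun η _ => ?_
    rw [smul_smul]
    congr 1
    ring
  simp_rw [h1]
  rw [intervalIntegral.integral_smul, hswap]
  have h2 : ∫ η in a..s, ∫ ξ in η..s, ((s - ξ) ^ (-α) * (ξ - η) ^ (α - 1) * (t - ξ)⁻¹) • φ η =
      ∫ η in a..s, (beta (1 - α) α * (t - s) ^ (-α)) • ((t - η) ^ (α - 1) • φ η) := by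
    refine intervalIntegral_congr_Ioo has fun η hη => ?_
    rw [intervalIntegral.integral_smul_const, (integral_betaKernel_div hη.2 hst hα).2, smul_smul,
      mul_assoc]
  rw [h2, intervalIntegral.integral_smul, smul_smul, smul_smul, smul_smul, beta_one_sub α,
    Real.rpow_neg hts.le]
  have := Real.rpow_pos_of_pos hts α
  have hα0 := hα.1
  rw [show α / Real.Gamma (1 - α) * ((t - s) ^ α / α) * (1 / Real.Gamma α) *
    (Real.Gamma (1 - α) * Real.Gamma α * ((t - s) ^ α)⁻¹) = 1 by field_simp, one_smul]

/-- For τ > s the kernel is continuous on [a, s]; its primitive gives (τ-s)^{-α}/α after dropping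
the negative contribution of the endpoint a. -/
theorem memory_integrable_and_norm_le {a s τ U : ℝ} {u : ℝ → E} (has : a ≤ s) (hsτ : s < τ)
    (hα : 0 < α) (hu : AEStronglyMeasurable u (volume.restrict (Ioc a s)))
    (hU : ∀ ξ ∈ Ioo a s, ‖u ξ‖ ≤ U) (hU0 : 0 ≤ U) :
    IntervalIntegrable (fun ξ => (τ - ξ) ^ (-1 - α) • u ξ) volume a s ∧
    ‖∫ ξ in a..s, (τ - ξ) ^ (-1 - α) • u ξ‖ ≤ (τ - s) ^ (-α) / α * U := by
  have hpos : ∀ ξ ∈ uIcc a s, 0 < τ - ξ := fun ξ hξ => by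
    rw [uIcc_of_le has] at hξ
    linarith [hξ.2]
  have hk : IntervalIntegrable (fun ξ => (τ - ξ) ^ (-1 - α)) volume a s := by
    refine ContinuousOn.intervalIntegrable ?_
    exact ContinuousOn.rpow_const (by fun_prop) fun x hx => Or.inl (hpos x hx).ne'
  have hk0 : ∀ ξ ∈ Ioo a s, 0 ≤ (τ - ξ) ^ (-1 - α) := fun ξ hξ =>
    Real.rpow_nonneg (by linarith [hξ.2]) _
  refine ⟨intervalIntegrable_smul_of_bound has hk hk0 hu hU,
    (norm_integral_smul_le_const has hk hk0 hU).trans (mul_le_mul_of_nonneg_right ?_ hU0)⟩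
  have h0 : (0 : ℝ) ∉ uIcc (τ - s) (τ - a) := by
    rw [uIcc_of_le (by linarith)]
    exact fun h => by linarith [h.1]
  rw [intervalIntegral.integral_comp_sub_left (fun x : ℝ => x ^ (-1 - α)) τ,
    integral_rpow (Or.inr ⟨by linarith, h0⟩), show -1 - α + 1 = -α by ring, div_neg, ← neg_div,
    neg_sub]
  gcongr
  have := Real.rpow_nonneg (show 0 ≤ τ - a by linarith) (-α)
  linarith

/-- The exponents α - 1 and -α sum to -1, so the beta integral scales like (t-s)^0. This is why the
convolution stays bounded as t approaches s although g may blow up. -/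
theorem intervalIntegrable_smul_of_singular_bound {s t N : ℝ} {g : ℝ → E} (hst : s ≤ t)
    (hα : α ∈ Ioo (0 : ℝ) 1)
    (hg : AEStronglyMeasurable g (volume.restrict (Ioc s t)))
    (hN : ∀ σ ∈ Ioo s t, ‖g σ‖ ≤ N * (σ - s) ^ (-α)) :
    IntervalIntegrable (fun σ => (t - σ) ^ (α - 1) • g σ) volume s t ∧
    (s < t → ‖∫ σ in s..t, (t - σ) ^ (α - 1) • g σ‖ ≤ N * beta α (1 - α)) := by
  have hα1 : 0 < 1 - α := sub_pos.2 hα.2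
  have hk : IntervalIntegrable (fun σ => (t - σ) ^ (α - 1) * (N * (σ - s) ^ (-α))) volume s t := by
    have := (intervalIntegrable_betaKernel hst hα.1 hα1).const_mul N
    rw [show 1 - α - 1 = -α by ring] at this
    refine this.congr fun σ _ => ?_
    ring
  constructor
  · refine hk.mono_fun' ?_ ?_
    · rw [uIoc_of_le hst]
      exact AEStronglyMeasurable.smul
        (Measurable.pow_const (by fun_prop) _).aestronglyMeasurable hg
    · refine ae_restrict_uIoc_of_forall_Ioo hst fun σ hσ => ?_
      beta_reduce
      rw [norm_smul, Real.norm_of_nonneg (leftKernel_nonneg σ hσ)]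
      exact mul_le_mul_of_nonneg_left (hN σ hσ) (leftKernel_nonneg σ hσ)
  · intro hlt
    refine (norm_integral_smul_le hst hk leftKernel_nonneg hN).trans_eq ?_
    have := integral_betaKernel hlt hα.1 hα1
    rw [show 1 - α - 1 = -α by ring, add_sub_cancel, sub_self, Real.rpow_zero, one_mul] at this
    rw [← this, ← intervalIntegral.integral_const_mul]
    congr 1; ext σ; ring

end Fractional

/-! ### Variation of constants -/

section Variation

variable {𝔸 E : Type*} [NormedRing 𝔸] [NormedAlgebra ℝ 𝔸]
  [NormedAddCommGroup E] [NormedSpace ℝ E] [CompleteSpace E] [Module 𝔸 E] [IsBoundedSMul 𝔸 E]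
  [IsScalarTower ℝ 𝔸 E]

theorem intervalIntegral_smul_vec [CompleteSpace 𝔸] {a b : ℝ} {f : ℝ → 𝔸} (hf : IntervalIntegrable f volume a b)
    (v : E) : (∫ τ in a..b, f τ) • v = ∫ τ in a..b, f τ • v := by
  let L : 𝔸 →L[ℝ] E := LinearMap.mkContinuous
    { toFun := fun a => a • v, map_add' := fun a b => add_smul a b v,
      map_smul' := fun c a => smul_assoc c a v } ‖v‖
    fun a => (norm_smul_le a v).trans_eq (mul_comm _ _)
  exact (L.intervalIntegral_comp_comm hf).symm

theorem intervalIntegral_vec_smul {a b : ℝ} {f : ℝ → E} (hf : IntervalIntegrable f volume a b)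
    (m : 𝔸) : m • (∫ τ in a..b, f τ) = ∫ τ in a..b, m • f τ := by
  let L : E →L[ℝ] E := LinearMap.mkContinuous
    { toFun := fun v => m • v, map_add' := smul_add m,
      map_smul' := fun c v => smul_comm m c v } ‖m‖ fun v => norm_smul_le m v
  exact (L.intervalIntegral_comp_comm hf).symm

/-- The resolvent applied to an inhomogeneity solves the inhomogeneous Volterra equation. -/
theorem variation_of_constants [CompleteSpace 𝔸] {α s r C D N T : ℝ} {A : ℝ → 𝔸} {R : ℝ → ℝ → 𝔸} {g z : ℝ → E}
    (hα : α ∈ Ioo (0 : ℝ) 1) (hA : ∀ τ, ‖A τ‖ ≤ C) (hAm : StronglyMeasurable A)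
    (hRm : StronglyMeasurable (Function.uncurry R)) (hRD : ∀ t s, ‖R t s‖ ≤ D)
    (hR : ∀ s t, s ≤ t → t - s ≤ T →
      R t s = (1 / Real.Gamma α) • 1 + volterraOp α s A (fun τ => R τ s) t)
    (hT : r - s ≤ T) (hg : StronglyMeasurable g) (hN0 : 0 ≤ N)
    (hN : ∀ σ ∈ Ioc s r, ‖g σ‖ ≤ N * (σ - s) ^ (-α))
    (hz : ∀ t, z t = ∫ σ in s..t, (t - σ) ^ (α - 1) • (R t σ • g σ)) :
    StronglyMeasurable z ∧ (∀ t ∈ Ioc s r, ‖z t‖ ≤ D * N * beta α (1 - α)) ∧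
    ∀ t ∈ Ioc s r,
      z t = (1 / Real.Gamma α) • ∫ τ in s..t, (t - τ) ^ (α - 1) • (A τ • z τ + g τ) := by
  have hC0 : 0 ≤ C := (norm_nonneg _).trans (hA 0)
  have hD0 : 0 ≤ D := (norm_nonneg _).trans (hRD 0 0)
  have hα1 : 0 < 1 - α := sub_pos.2 hα.2
  have hRt : ∀ t, StronglyMeasurable fun σ => R t σ := fun t =>
    hRm.comp_measurable (measurable_const.prodMk measurable_id)
  have hRs : ∀ σ, StronglyMeasurable fun t => R t σ := fun σ =>
    hRm.comp_measurable (measurable_id.prodMk measurable_const)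
  have hzm : StronglyMeasurable z := by
    rw [funext hz]
    refine stronglyMeasurable_intervalIntegral
      (f := fun t σ => (t - σ) ^ (α - 1) • (R t σ • g σ)) ?_ measurable_const measurable_id
    have h : Measurable fun p : ℝ × ℝ => (p.1 - p.2) ^ (α - 1) :=
      Measurable.pow_const (by fun_prop) _
    exact h.stronglyMeasurable.smul (hRm.smul (hg.comp_measurable measurable_snd))
  have hRg : ∀ t ≤ r, ∀ σ ∈ Ioo s t, ‖R t σ • g σ‖ ≤ D * N * (σ - s) ^ (-α) := fun t ht σ hσ => by
    rw [mul_assoc]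
    exact (norm_smul_le _ _).trans (mul_le_mul (hRD t σ) (hN σ ⟨hσ.1, hσ.2.le.trans ht⟩)
      (norm_nonneg _) hD0)
  have hRgi : ∀ t ∈ Ioc s r,
      IntervalIntegrable (fun σ => (t - σ) ^ (α - 1) • (R t σ • g σ)) volume s t ∧
      (s < t → ‖∫ σ in s..t, (t - σ) ^ (α - 1) • (R t σ • g σ)‖ ≤ D * N * beta α (1 - α)) :=
    fun t ht => intervalIntegrable_smul_of_singular_bound ht.1.le hα
    ((hRt t).smul hg).aestronglyMeasurable (hRg t ht.2)
  have hzb : ∀ t ∈ Ioc s r, ‖z t‖ ≤ D * N * beta α (1 - α) := fun t ht => by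
    rw [hz]
    exact (hRgi t ht).2 ht.1
  refine ⟨hzm, hzb, fun t ht => ?_⟩
  have hst := ht.1
  have hgi : IntervalIntegrable (fun σ => (t - σ) ^ (α - 1) • g σ) volume s t :=
    (intervalIntegrable_smul_of_singular_bound ht.1.le hα hg.aestronglyMeasurable
      fun σ hσ => hN σ ⟨hσ.1, hσ.2.le.trans ht.2⟩).1
  have hAzi : IntervalIntegrable (fun τ => (t - τ) ^ (α - 1) • (A τ • z τ)) volume s t :=
    intervalIntegrable_smul_of_bound hst.le (intervalIntegrable_leftKernel t hα.1)
      leftKernel_nonneg (hAm.smul hzm).aestronglyMeasurable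
      fun τ hτ => (norm_smul_le _ _).trans (mul_le_mul (hA τ)
        (hzb τ ⟨hτ.1, hτ.2.le.trans ht.2⟩) (norm_nonneg _) hC0)
  have hkm : Measurable fun p : ℝ × ℝ => (t - p.1) ^ (α - 1) * (p.1 - p.2) ^ (α - 1) :=
    (Measurable.pow_const (by fun_prop) _).mul (Measurable.pow_const (by fun_prop) _)
  -- The choice c = 1 - α accommodates the singularity (σ-s)^{-α} of g.
  have hswap := integral_triangle_swap (s := s) (t := t) (a := α) (b := α) (c := 1 - α)
    (C := C * (D * N)) hst.le hα.1 hα.1 hα1 (by positivity)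
    (f := fun τ σ => ((t - τ) ^ (α - 1) * (τ - σ) ^ (α - 1)) • (A τ • (R τ σ • g σ)))
    (hkm.stronglyMeasurable.smul ((hAm.comp_measurable measurable_fst).smul
      (hRm.smul (hg.comp_measurable measurable_snd))))
    (fun τ σ h1 h2 h3 => by
      have h4 : 0 ≤ (t - τ) ^ (α - 1) * (τ - σ) ^ (α - 1) :=
        mul_nonneg (Real.rpow_nonneg (sub_nonneg.2 h3.le) _)
          (Real.rpow_nonneg (sub_nonneg.2 h2.le) _)
      have h5 : ‖A τ • (R τ σ • g σ)‖ ≤ C * (D * N * (σ - s) ^ (-α)) :=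
        (norm_smul_le _ _).trans (mul_le_mul (hA τ) (hRg τ (h3.le.trans ht.2) σ ⟨h1, h2⟩)
          (norm_nonneg _) hC0)
      rw [norm_smul, Real.norm_of_nonneg h4, show 1 - α - 1 = -α by ring]
      refine (mul_le_mul_of_nonneg_left h5 h4).trans_eq ?_
      ring)
  have hin1 : ∀ τ ∈ Ioo s t, (t - τ) ^ (α - 1) • (A τ • z τ) =
      ∫ σ in s..τ, ((t - τ) ^ (α - 1) * (τ - σ) ^ (α - 1)) • (A τ • (R τ σ • g σ)) := by
    intro τ hτ
    rw [hz τ, intervalIntegral_vec_smul (hRgi τ ⟨hτ.1, hτ.2.le.trans ht.2⟩).1,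
      ← intervalIntegral.integral_smul]
    congr 1; ext σ
    rw [smul_comm (A τ), smul_smul]
  -- The resolvent equation for R(·, σ): the outer kernel (t-σ)^{α-1} cancels the regularizing
  -- factor (t-σ)^{1-α}.
  have hin2 : ∀ σ ∈ Ioo s t, (t - σ) ^ (α - 1) • (R t σ • g σ) -
      (1 / Real.Gamma α) • ((t - σ) ^ (α - 1) • g σ) = (1 / Real.Gamma α) •
      ∫ τ in σ..t, ((t - τ) ^ (α - 1) * (τ - σ) ^ (α - 1)) • (A τ • (R τ σ • g σ)) := by
    intro σ hσ
    have hpos : 0 < t - σ := sub_pos.2 hσ.2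
    have h1 := intervalIntegrable_volterra (f := fun τ => R τ σ) (s := σ) (t := t) hα.1 hA hAm
      hσ.2.le (hRs σ).aestronglyMeasurable fun τ _ => hRD τ σ
    rw [hR σ t hσ.2.le (by linarith [hσ.1, ht.2]), add_smul, smul_add, volterraOp, smul_assoc,
      smul_assoc, one_smul, smul_comm _ (1 / Real.Gamma α), add_sub_cancel_left, smul_smul,
      intervalIntegral_smul_vec h1]
    congr 1
    · rw [mul_div_assoc', ← Real.rpow_add hpos]
      simp
    · congr 1; ext τ
      rw [smul_assoc, smul_assoc]
  have hgi' : IntervalIntegrable (fun σ => (1 / Real.Gamma α) • ((t - σ) ^ (α - 1) • g σ))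
      volume s t := hgi.smul _
  have hz1 : z t - (1 / Real.Gamma α) • ∫ σ in s..t, (t - σ) ^ (α - 1) • g σ =
      (1 / Real.Gamma α) • ∫ τ in s..t, (t - τ) ^ (α - 1) • (A τ • z τ) := by
    rw [intervalIntegral_congr_Ioo hst.le hin1, hswap, hz, ← intervalIntegral.integral_smul,
      ← intervalIntegral.integral_sub (hRgi t ht).1 hgi',
      intervalIntegral_congr_Ioo hst.le hin2, intervalIntegral.integral_smul]
  simp_rw [smul_add]
  rw [intervalIntegral.integral_add hAzi hgi, smul_add, ← hz1, sub_add_cancel]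

end Variation

/-! ### The Cauchy problem in integral form -/

noncomputable section

section Memory

variable {E : Type*} [NormedAddCommGroup E] [NormedSpace ℝ E] {α a s : ℝ}

/-- The contribution of the history `u` on `[a, s]` to the Caputo derivative after `s`,
with the opposite sign. -/
def memoryTerm (α a s : ℝ) (u : ℝ → E) (τ : ℝ) : E :=
  (α / Real.Gamma (1 - α)) • ∫ ξ in a..s, (τ - ξ) ^ (-1 - α) • u ξ

theorem stronglyMeasurable_memoryTerm {u : ℝ → E} (hu : StronglyMeasurable u) :
    StronglyMeasurable (memoryTerm α a s u) := by
  refine StronglyMeasurable.const_smul (stronglyMeasurable_intervalIntegral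
    (f := fun τ ξ => (τ - ξ) ^ (-1 - α) • u ξ) ?_ measurable_const measurable_const) _
  have h : Measurable fun p : ℝ × ℝ => (p.1 - p.2) ^ (-1 - α) := Measurable.pow_const (by fun_prop) _
  exact h.stronglyMeasurable.smul (hu.comp_measurable measurable_snd)

theorem memoryTerm_congr {u v : ℝ → E} (has : a ≤ s) (h : ∀ ξ ∈ Ioo a s, u ξ = v ξ) :
    memoryTerm α a s u = memoryTerm α a s v := by
  ext τ
  rw [memoryTerm, memoryTerm]
  congr 1
  exact intervalIntegral_congr_Ioo has fun ξ hξ => by rw [h ξ hξ]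

theorem exists_norm_memoryTerm_le {φ : ℝ → E} {C : ℝ} (hα : α ∈ Ioo (0 : ℝ) 1) (has : a ≤ s)
    (hφ : StronglyMeasurable φ) (hC : ∀ τ, ‖φ τ‖ ≤ C) :
    ∃ N, 0 ≤ N ∧ ∀ τ, s < τ → IntervalIntegrable
        (fun ξ => (τ - ξ) ^ (-1 - α) • rlIntegral α a φ ξ) volume a s ∧
      ‖memoryTerm α a s (rlIntegral α a φ) τ‖ ≤ N * (τ - s) ^ (-α) := by
  have hC0 : 0 ≤ C := (norm_nonneg _).trans (hC 0)
  have h1 : 0 ≤ s - a := sub_nonneg.2 has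
  have hα0 := hα.1
  have hG := Real.Gamma_pos_of_pos hα0
  have hG1 := Real.Gamma_pos_of_pos (sub_pos.2 hα.2)
  set U := 1 / Real.Gamma α * ((s - a) ^ α / α * C)
  have hU : 0 ≤ U := by positivity
  refine ⟨α / Real.Gamma (1 - α) * (1 / α * U), by positivity, fun τ hτ => ?_⟩
  obtain ⟨h2, h3⟩ := memory_integrable_and_norm_le has hτ hα0
    (stronglyMeasurable_rlIntegral hφ α a).aestronglyMeasurable
    (fun ξ hξ => norm_rlIntegral_le_of_le hα0 hξ.1.le hξ.2.le hC0 hC) hU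
  refine ⟨h2, ?_⟩
  rw [memoryTerm, norm_smul, Real.norm_of_nonneg (by positivity), mul_assoc]
  refine mul_le_mul_of_nonneg_left (h3.trans_eq ?_) (by positivity)
  ring

/-- A fractional integral, restarted at `s`: the past is replaced by its memory term. -/
theorem rlIntegral_eq_integral_memoryTerm_add [CompleteSpace E] {φ : ℝ → E} {C t : ℝ}
    (hα : α ∈ Ioo (0 : ℝ) 1) (has : a ≤ s) (hst : s < t) (hφ : StronglyMeasurable φ)
    (hC : ∀ τ, ‖φ τ‖ ≤ C) :
    rlIntegral α a φ t = (1 / Real.Gamma α) • ∫ τ in s..t, (t - τ) ^ (α - 1) •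
      (memoryTerm α a s (rlIntegral α a φ) τ + φ τ) := by
  obtain ⟨N, -, hN⟩ := exists_norm_memoryTerm_le hα has hφ hC
  have hint : IntervalIntegrable (fun τ => (t - τ) ^ (α - 1) • φ τ) volume a t :=
    intervalIntegrable_smul_of_bound (has.trans hst.le) (intervalIntegrable_leftKernel t hα.1)
      leftKernel_nonneg hφ.aestronglyMeasurable fun τ _ => hC τ
  have h1 : IntervalIntegrable (fun τ => (t - τ) ^ (α - 1) • φ τ) volume a s :=
    hint.mono_set (by
      rw [uIcc_of_le has, uIcc_of_le (has.trans hst.le)]; exact Icc_subset_Icc_right hst.le)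
  have h2 : IntervalIntegrable (fun τ => (t - τ) ^ (α - 1) • φ τ) volume s t :=
    hint.mono_set (by
      rw [uIcc_of_le hst.le, uIcc_of_le (has.trans hst.le)]; exact Icc_subset_Icc_left has)
  have h3 : IntervalIntegrable (fun τ => (t - τ) ^ (α - 1) •
      memoryTerm α a s (rlIntegral α a φ) τ) volume s t :=
    (intervalIntegrable_smul_of_singular_bound hst.le hα
      (stronglyMeasurable_memoryTerm (stronglyMeasurable_rlIntegral hφ α a)).aestronglyMeasurable
      fun σ hσ => (hN σ hσ.1).2).1
  simp_rw [smul_add]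
  rw [intervalIntegral.integral_add h3 h2, rlIntegral,
    ← intervalIntegral.integral_add_adjacent_intervals h1 h2]
  congr 2
  exact (integral_memory has hst hα hφ hC).symm

end Memory

/-! ### Existence, uniqueness and representation for the integral equation -/

section Cauchy

variable {𝔸 E : Type*} [NormedRing 𝔸] [NormedAddCommGroup E] [NormedSpace ℝ E] [Module 𝔸 E]
  [IsBoundedSMul 𝔸 E] {α a s r : ℝ} {A : ℝ → 𝔸} {C D T B L : ℝ} {R : ℝ → ℝ → 𝔸} {b φ : ℝ → E}
  {v : E}

theorem exists_norm_forcing_le (hα : α ∈ Ioo (0 : ℝ) 1) (has : a ≤ s) (hsr : s < r)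
    (hA : ∀ τ, ‖A τ‖ ≤ C) (hB : ∀ τ, ‖b τ‖ ≤ B)
    (hφ : StronglyMeasurable φ) (hL : ∀ τ, ‖φ τ‖ ≤ L) :
    ∃ K, 0 ≤ K ∧ ∀ σ ∈ Ioc s r,
      ‖A σ • v + memoryTerm α a s (rlIntegral α a φ) σ + b σ‖ ≤ K * (σ - s) ^ (-α) := by
  obtain ⟨N, hN0, hN⟩ := exists_norm_memoryTerm_le hα has hφ hL
  have hC0 : 0 ≤ C := (norm_nonneg _).trans (hA 0)
  have hB0 : 0 ≤ B := (norm_nonneg _).trans (hB 0)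
  have hrs : 0 < r - s := sub_pos.2 hsr
  refine ⟨(C * ‖v‖ + B) * (r - s) ^ α + N, by positivity, fun σ hσ => ?_⟩
  have hσs : 0 < σ - s := sub_pos.2 hσ.1
  -- Lets the bounded summands of the forcing be absorbed into the singular bound.
  have h1 : 1 ≤ (r - s) ^ α * (σ - s) ^ (-α) := by
    rw [Real.rpow_neg hσs.le, ← div_eq_mul_inv, one_le_div (Real.rpow_pos_of_pos hσs _)]
    have := hσ.2
    have := hα.1
    gcongr
  have h2 : ‖A σ • v‖ ≤ C * ‖v‖ :=
    (norm_smul_le _ _).trans (mul_le_mul_of_nonneg_right (hA σ) (norm_nonneg _))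
  have h3 : 0 ≤ C * ‖v‖ + B := by positivity
  calc _ ≤ ‖A σ • v‖ + ‖memoryTerm α a s (rlIntegral α a φ) σ‖ + ‖b σ‖ := norm_add₃_le
    _ ≤ C * ‖v‖ + N * (σ - s) ^ (-α) + B := add_le_add (add_le_add h2 (hN σ hσ.1).2) (hB σ)
    _ = (C * ‖v‖ + B) * 1 + N * (σ - s) ^ (-α) := by ring
    _ ≤ (C * ‖v‖ + B) * ((r - s) ^ α * (σ - s) ^ (-α)) + N * (σ - s) ^ (-α) := by gcongr
    _ = _ := by ring

variable [NormedAlgebra ℝ 𝔸] [IsScalarTower ℝ 𝔸 E]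

/-- Bounded solutions of the inhomogeneous Volterra equation are unique. -/
theorem eqOn_of_volterra {y z g : ℝ → E} {M N K : ℝ} (hα : α ∈ Ioo (0 : ℝ) 1)
    (hA : ∀ τ, ‖A τ‖ ≤ C) (hAm : StronglyMeasurable A) (hg : StronglyMeasurable g)
    (hK : ∀ σ ∈ Ioc s r, ‖g σ‖ ≤ K * (σ - s) ^ (-α))
    (hym : AEStronglyMeasurable y (volume.restrict (Ioc s r)))
    (hzm : AEStronglyMeasurable z (volume.restrict (Ioc s r)))
    (hyM : ∀ t ∈ Ioc s r, ‖y t‖ ≤ M) (hzN : ∀ t ∈ Ioc s r, ‖z t‖ ≤ N)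
    (hy : ∀ t ∈ Ioc s r,
      y t = (1 / Real.Gamma α) • ∫ τ in s..t, (t - τ) ^ (α - 1) • (A τ • y τ + g τ))
    (hz : ∀ t ∈ Ioc s r,
      z t = (1 / Real.Gamma α) • ∫ τ in s..t, (t - τ) ^ (α - 1) • (A τ • z τ + g τ)) :
    ∀ t ∈ Ioc s r, y t = z t := by
  have hC0 : 0 ≤ C := (norm_nonneg _).trans (hA 0)
  have hint : ∀ {y : ℝ → E} {M : ℝ}, AEStronglyMeasurable y (volume.restrict (Ioc s r)) →
      (∀ t ∈ Ioc s r, ‖y t‖ ≤ M) → ∀ t ∈ Ioc s r,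
      IntervalIntegrable (fun τ => (t - τ) ^ (α - 1) • (A τ • y τ + g τ)) volume s t := by
    intro y M hym hyM t ht
    have h1 : IntervalIntegrable (fun τ => (t - τ) ^ (α - 1) • (A τ • y τ)) volume s t :=
      intervalIntegrable_smul_of_bound ht.1.le (intervalIntegrable_leftKernel t hα.1)
        leftKernel_nonneg (hAm.aestronglyMeasurable.smul
          (hym.mono_measure (Measure.restrict_mono_set _ (Ioc_subset_Ioc_right ht.2))))
        fun τ hτ => (norm_smul_le _ _).trans (mul_le_mul (hA τ)
          (hyM τ ⟨hτ.1, hτ.2.le.trans ht.2⟩) (norm_nonneg _) hC0)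
    have h2 : IntervalIntegrable (fun τ => (t - τ) ^ (α - 1) • g τ) volume s t :=
      (intervalIntegrable_smul_of_singular_bound ht.1.le hα hg.aestronglyMeasurable
        fun σ hσ => hK σ ⟨hσ.1, hσ.2.le.trans ht.2⟩).1
    simp_rw [smul_add]
    exact h1.add h2
  intro t ht
  have hα1 : 0 < 1 - α := sub_pos.2 hα.2
  have hM0 : 0 ≤ M := (norm_nonneg _).trans (hyM t ht)
  have hN0 : 0 ≤ N := (norm_nonneg _).trans (hzN t ht)
  have hpos : ∀ t ∈ Ioc s r, 0 < t - s := fun t ht => sub_pos.2 ht.1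
  -- Multiplying the difference by (t-s)^{1-α} turns the ordinary homogeneous Volterra equation into
  -- the regularized one, and keeps the function bounded.
  have key := eq_zero_of_eq_volterraOp (s := s) (r := r) (M := (r - s) ^ (1 - α) * (M + N))
    (f := fun t => (t - s) ^ (1 - α) • (y t - z t)) hα hA ?_ ?_ t ht
  · have h1 : (t - s) ^ (1 - α) ≠ 0 := (Real.rpow_pos_of_pos (hpos t ht) _).ne'
    exact sub_eq_zero.1 ((smul_eq_zero.1 key).resolve_left h1)
  · intro t ht
    have := hpos t ht
    rw [norm_smul, Real.norm_of_nonneg (by positivity)]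
    have h2 := (norm_sub_le (y t) (z t)).trans (add_le_add (hyM t ht) (hzN t ht))
    have h3 : (t - s) ^ (1 - α) ≤ (r - s) ^ (1 - α) := by
      have := ht.2
      gcongr
    exact mul_le_mul h3 h2 (norm_nonneg _) (Real.rpow_nonneg (by linarith [ht.2]) _)
  · intro t ht
    rw [volterraOp, hy t ht, hz t ht, ← smul_sub,
      ← intervalIntegral.integral_sub (hint hym hyM t ht) (hint hzm hzN t ht), smul_smul,
      mul_one_div]
    congr 1
    refine intervalIntegral_congr_Ioo ht.1.le fun τ hτ => ?_
    have hτs : 0 < τ - s := sub_pos.2 hτ.1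
    rw [← smul_sub, add_sub_add_right_eq_sub, ← smul_sub, smul_comm (A τ), smul_smul, mul_assoc,
      ← Real.rpow_add hτs]
    simp

variable [CompleteSpace 𝔸] [CompleteSpace E]

/-- The solution of the Cauchy problem in integral form exists. -/
theorem exists_solution (hα : α ∈ Ioo (0 : ℝ) 1) (has : a ≤ s) (hsr : s < r)
    (hA : ∀ τ, ‖A τ‖ ≤ C) (hAm : StronglyMeasurable A) (hB : ∀ τ, ‖b τ‖ ≤ B)
    (hbm : StronglyMeasurable b) (hφ : StronglyMeasurable φ) (hL : ∀ τ, ‖φ τ‖ ≤ L) :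
    ∃ (x ψ : ℝ → E) (M : ℝ), StronglyMeasurable ψ ∧ (∀ τ, ‖ψ τ‖ ≤ M) ∧
      (∀ t ∈ Icc a r, x t = v + rlIntegral α a ψ t) ∧
      (∀ t ∈ Icc a s, x t = v + rlIntegral α a φ t) ∧
      ∀ t ∈ Ioc s r, ψ t = A t • x t + b t := by
  obtain ⟨R, D, hRm, hD0, hRD, hR⟩ := exists_resolvent hα hA hAm (r - s)
  obtain ⟨K, hK0, hK⟩ := exists_norm_forcing_le (v := v) hα has hsr hA hB hφ hL
  set g : ℝ → E := fun σ => A σ • v + memoryTerm α a s (rlIntegral α a φ) σ + b σ with hg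
  have hgm : StronglyMeasurable g := ((hAm.smul stronglyMeasurable_const).add
    (stronglyMeasurable_memoryTerm (stronglyMeasurable_rlIntegral hφ α a))).add hbm
  set z : ℝ → E := fun t => ∫ σ in s..t, (t - σ) ^ (α - 1) • (R t σ • g σ) with hz
  obtain ⟨hzm, hzb, hzeq⟩ := variation_of_constants (z := z) hα hA hAm hRm hRD hR le_rfl hgm hK0 hK
    fun t => rfl
  have hC0 : 0 ≤ C := (norm_nonneg _).trans (hA 0)
  have hB0 : 0 ≤ B := (norm_nonneg _).trans (hB 0)
  have hL0 : 0 ≤ L := (norm_nonneg _).trans (hL 0)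
  set Z : ℝ := D * K * beta α (1 - α)
  have hZ0 : 0 ≤ Z := by
    have := (beta_pos hα.1 (sub_pos.2 hα.2)).le
    positivity
  set η : ℝ → E := (Ioc s r).indicator fun t => A t • (v + z t) + b t with hη
  have hηb : ∀ t, ‖η t‖ ≤ C * (‖v‖ + Z) + B := fun t => by
    by_cases ht : t ∈ Ioc s r
    · rw [hη, indicator_of_mem ht]
      refine (norm_add_le _ _).trans (add_le_add ((norm_smul_le _ _).trans (mul_le_mul (hA t)
        ((norm_add_le _ _).trans ?_) (norm_nonneg _) hC0)) (hB t))
      exact add_le_add le_rfl (hzb t ht)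
    · rw [hη, indicator_of_notMem ht, norm_zero]; positivity
  -- The density of the solution: the given one up to s, then A(v + z) + b. Restarting I^α ψ at s
  -- reproduces the equation of z, hence I^α ψ = z there.
  set ψ : ℝ → E := fun t => (Iic s).indicator φ t + η t with hψ
  have hψm : StronglyMeasurable ψ := (hφ.indicator measurableSet_Iic).add
    (((hAm.smul (stronglyMeasurable_const.add hzm)).add hbm).indicator measurableSet_Ioc)
  have hψb : ∀ t, ‖ψ t‖ ≤ L + (C * (‖v‖ + Z) + B) := fun t =>
    (norm_add_le _ _).trans (add_le_add ((norm_indicator_le_norm_self _ _).trans (hL t)) (hηb t))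
  have hψ1 : ∀ t ≤ s, ψ t = φ t := fun t ht => by
    simp [hψ, hη, ht]
  have hψ2 : ∀ t ∈ Ioc s r, ψ t = A t • (v + z t) + b t := fun t ht => by
    have h1 : t ∉ Iic s := fun h => ht.1.not_ge h
    simp [hψ, hη, indicator_of_mem ht, indicator_of_notMem h1]
  have hrl1 : ∀ t ∈ Icc a s, rlIntegral α a ψ t = rlIntegral α a φ t := fun t ht => by
    rw [rlIntegral, rlIntegral]
    congr 1
    exact intervalIntegral_congr_Ioo ht.1 fun τ hτ => by rw [hψ1 τ (hτ.2.le.trans ht.2)]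
  have hrl2 : ∀ t ∈ Ioc s r, rlIntegral α a ψ t = z t := fun t ht => by
    rw [rlIntegral_eq_integral_memoryTerm_add hα has ht.1 hψm hψb, hzeq t ht,
      memoryTerm_congr has fun ξ hξ => hrl1 ξ ⟨hξ.1.le, hξ.2.le⟩]
    congr 1
    refine intervalIntegral_congr_Ioo ht.1.le fun τ hτ => ?_
    rw [hψ2 τ ⟨hτ.1, hτ.2.le.trans ht.2⟩, hg, smul_add (A τ)]
    congr 1
    beta_reduce
    abel
  refine ⟨fun t => v + rlIntegral α a ψ t, ψ, _, hψm, hψb, fun _ _ => rfl, fun t ht => ?_,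
    fun t ht => ?_⟩
  · beta_reduce
    rw [hrl1 t ht]
  · beta_reduce
    rw [hrl2 t ht, hψ2 t ht]

/-- The Cauchy formula for a solution of the Cauchy problem in integral form. -/
theorem representation (hα : α ∈ Ioo (0 : ℝ) 1) (has : a ≤ s) (hsr : s < r)
    (hA : ∀ τ, ‖A τ‖ ≤ C) (hAm : StronglyMeasurable A) (hB : ∀ τ, ‖b τ‖ ≤ B)
    (hbm : StronglyMeasurable b) (hφ : StronglyMeasurable φ) (hL : ∀ τ, ‖φ τ‖ ≤ L)
    (hRm : StronglyMeasurable (Function.uncurry R)) (hRD : ∀ t s, ‖R t s‖ ≤ D)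
    (hR : ∀ s t, s ≤ t → t - s ≤ T →
      R t s = (1 / Real.Gamma α) • 1 + volterraOp α s A (fun τ => R τ s) t)
    (hT : r - s ≤ T) {x : ℝ → E} (hx : ∀ t ∈ Icc a r, x t = v + rlIntegral α a φ t)
    (hxφ : ∀ᵐ t ∂(volume.restrict (Ioc s r)), φ t = A t • x t + b t) {t : ℝ} (ht : t ∈ Ioc s r) :
    IntervalIntegrable (fun τ => (t - τ) ^ (α - 1) • (R t τ * A τ)) volume s t ∧
    (∀ τ ∈ Ioc s t, IntervalIntegrable (fun ξ => (τ - ξ) ^ (-1 - α) • rlIntegral α a φ ξ)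
      volume a s) ∧
    IntervalIntegrable (fun τ => (t - τ) ^ (α - 1) •
      (R t τ • ∫ ξ in a..s, (τ - ξ) ^ (-1 - α) • rlIntegral α a φ ξ)) volume s t ∧
    IntervalIntegrable (fun τ => (t - τ) ^ (α - 1) • (R t τ • b τ)) volume s t ∧
    x t = (1 + ∫ τ in s..t, (t - τ) ^ (α - 1) • (R t τ * A τ)) • v +
      (α / Real.Gamma (1 - α)) • (∫ τ in s..t, (t - τ) ^ (α - 1) •
        (R t τ • ∫ ξ in a..s, (τ - ξ) ^ (-1 - α) • rlIntegral α a φ ξ)) +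
      ∫ τ in s..t, (t - τ) ^ (α - 1) • (R t τ • b τ) := by
  obtain ⟨N, hN0, hN⟩ := exists_norm_memoryTerm_le hα has hφ hL
  obtain ⟨K, hK0, hK⟩ := exists_norm_forcing_le (v := v) hα has hsr hA hB hφ hL
  have hD0 : 0 ≤ D := (norm_nonneg _).trans (hRD 0 0)
  have hL0 : 0 ≤ L := (norm_nonneg _).trans (hL 0)
  have hα1 := sub_pos.2 hα.2
  have hc : α / Real.Gamma (1 - α) ≠ 0 := (div_pos hα.1 (Real.Gamma_pos_of_pos hα1)).ne'
  have hum := stronglyMeasurable_rlIntegral hφ α a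
  have hmm : StronglyMeasurable (memoryTerm α a s (rlIntegral α a φ)) :=
    stronglyMeasurable_memoryTerm hum
  set g : ℝ → E := fun σ => A σ • v + memoryTerm α a s (rlIntegral α a φ) σ + b σ with hg
  have hgm : StronglyMeasurable g := ((hAm.smul stronglyMeasurable_const).add hmm).add hbm
  set z : ℝ → E := fun t => ∫ σ in s..t, (t - σ) ^ (α - 1) • (R t σ • g σ) with hz
  obtain ⟨hzm, hzb, hzeq⟩ := variation_of_constants (z := z) hα hA hAm hRm hRD hR hT hgm hK0 hK
    fun t => rfl
  -- Restarted at s, I^α φ satisfies the same Volterra equation as z, because φ = A x + b almost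
  -- everywhere; uniqueness applies.
  have hrl : ∀ t ∈ Ioc s r, rlIntegral α a φ t = z t := by
    refine eqOn_of_volterra hα hA hAm hgm hK hum.aestronglyMeasurable hzm.aestronglyMeasurable
      (fun t ht => norm_rlIntegral_le_of_le hα.1 (has.trans ht.1.le) ht.2 hL0 hL) hzb
      (fun t ht => ?_) hzeq
    rw [rlIntegral_eq_integral_memoryTerm_add hα has ht.1 hφ hL]
    congr 1
    refine intervalIntegral.integral_congr_ae ?_
    rw [ae_restrict_iff' measurableSet_Ioc] at hxφ
    filter_upwards [hxφ] with τ hτ hτt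
    rw [uIoc_of_le ht.1.le] at hτt
    have hτr : τ ≤ r := hτt.2.trans ht.2
    rw [hτ ⟨hτt.1, hτr⟩, hx τ ⟨has.trans hτt.1.le, hτr⟩, hg, smul_add (A τ)]
    congr 1
    beta_reduce
    abel
  have hRt : StronglyMeasurable fun σ => R t σ :=
    hRm.comp_measurable (measurable_const.prodMk measurable_id)
  have hker := intervalIntegrable_leftKernel (c := s) (t := t) t hα.1
  have hi1 : IntervalIntegrable (fun τ => (t - τ) ^ (α - 1) • (R t τ * A τ)) volume s t :=
    intervalIntegrable_smul_of_bound ht.1.le hker leftKernel_nonneg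
      (hRt.mul hAm).aestronglyMeasurable fun τ _ =>
        (norm_mul_le _ _).trans (mul_le_mul (hRD t τ) (hA τ) (norm_nonneg _) hD0)
  have hi3 : IntervalIntegrable (fun τ => (t - τ) ^ (α - 1) •
      (R t τ • memoryTerm α a s (rlIntegral α a φ) τ)) volume s t := by
    refine (intervalIntegrable_smul_of_singular_bound (N := D * N) ht.1.le hα
      (hRt.smul hmm).aestronglyMeasurable fun σ hσ => ?_).1
    rw [mul_assoc]
    exact (norm_smul_le _ _).trans (mul_le_mul (hRD t σ) (hN σ hσ.1).2 (norm_nonneg _) hD0)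
  have hi4 : IntervalIntegrable (fun τ => (t - τ) ^ (α - 1) • (R t τ • b τ)) volume s t :=
    intervalIntegrable_smul_of_bound ht.1.le hker leftKernel_nonneg
      (hRt.smul hbm).aestronglyMeasurable fun τ _ =>
        (norm_smul_le _ _).trans (mul_le_mul (hRD t τ) (hB τ) (norm_nonneg _) hD0)
  have hi1v : IntervalIntegrable (fun τ => ((t - τ) ^ (α - 1) • (R t τ * A τ)) • v) volume s t := by
    simp_rw [smul_assoc]
    exact intervalIntegrable_smul_of_bound ht.1.le hker leftKernel_nonneg
      ((hRt.mul hAm).smul stronglyMeasurable_const).aestronglyMeasurable fun τ _ =>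
        (norm_smul_le _ _).trans (mul_le_mul_of_nonneg_right ((norm_mul_le _ _).trans
          (mul_le_mul (hRD t τ) (hA τ) (norm_nonneg _) hD0)) (norm_nonneg v))
  have hmem : ∀ τ, (t - τ) ^ (α - 1) • (R t τ • memoryTerm α a s (rlIntegral α a φ) τ) =
      (α / Real.Gamma (1 - α)) • ((t - τ) ^ (α - 1) •
        (R t τ • ∫ ξ in a..s, (τ - ξ) ^ (-1 - α) • rlIntegral α a φ ξ)) := fun τ => by
    rw [memoryTerm, smul_comm (R t τ), smul_comm ((t - τ) ^ (α - 1))]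
  refine ⟨hi1, fun τ hτ => (hN τ hτ.1).1, ?_, hi4, ?_⟩
  -- Integrability is known for the normalized memory term; the nonzero constant is divided out.
  · have := hi3.smul (α / Real.Gamma (1 - α))⁻¹
    refine this.congr fun τ _ => ?_
    rw [Pi.smul_apply, hmem, inv_smul_smul₀ hc]
  · have hsplit : ∀ τ, (t - τ) ^ (α - 1) • (R t τ • g τ) =
        ((t - τ) ^ (α - 1) • (R t τ * A τ)) • v +
        (t - τ) ^ (α - 1) • (R t τ • memoryTerm α a s (rlIntegral α a φ) τ) +
        (t - τ) ^ (α - 1) • (R t τ • b τ) := fun τ => by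
      rw [hg, smul_add, smul_add, smul_add, smul_add, smul_assoc, mul_smul]
    rw [hx t ⟨has.trans ht.1.le, ht.2⟩, hrl t ht, hz]
    simp only
    simp_rw [hsplit]
    rw [intervalIntegral.integral_add (hi1v.add hi3) hi4, intervalIntegral.integral_add hi1v hi3,
      ← intervalIntegral_smul_vec hi1]
    simp_rw [hmem]
    rw [intervalIntegral.integral_smul, add_smul, one_smul]
    abel

end Cauchy

end

/-! ### The matrix case -/

theorem MemC.aestronglyMeasurable {X : Type*} [NormedAddCommGroup X] {a b : ℝ} {f : ℝ → X}
    (hf : MemC a b f) : AEStronglyMeasurable f (volume.restrict (Ioc a b)) :=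
  (ContinuousOn.mono hf Ioc_subset_Icc_self).aestronglyMeasurable measurableSet_Ioc

attribute [local instance] Matrix.linftyOpNormedRing Matrix.linftyOpNormedAlgebra

theorem isBoundedSMul_matrix (n : ℕ) :
    IsBoundedSMul (Matrix (Fin n) (Fin n) ℝ) (Fin n → ℝ) :=
  .of_norm_smul_le fun A v => Matrix.linfty_opNorm_mulVec A v

attribute [local instance] isBoundedSMul_matrix

theorem completeSpace_matrix (n : ℕ) : CompleteSpace (Matrix (Fin n) (Fin n) ℝ) :=
  FiniteDimensional.complete ℝ _

attribute [local instance] completeSpace_matrix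

theorem ae_restrict_uIoc_of_Icc {p : ℝ → Prop} {a b s t : ℝ}
    (h : ∀ᵐ x ∂(volume.restrict (Icc a b)), p x) (has : a ≤ s) (hst : s ≤ t) (htb : t ≤ b) :
    ∀ᵐ x ∂(volume.restrict (Ι s t)), p x := by
  refine ae_restrict_of_ae_restrict_of_subset ?_ h
  rw [uIoc_of_le hst]
  exact Ioc_subset_Icc_self.trans (Icc_subset_Icc has htb)

theorem rlIntegral_congr_ae {X : Type*} [NormedAddCommGroup X] [NormedSpace ℝ X] {β a b t : ℝ}
    {φ ψ : ℝ → X} (h : ∀ᵐ x ∂(volume.restrict (Icc a b)), φ x = ψ x) (ht : t ∈ Icc a b) :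
    rlIntegral β a φ t = rlIntegral β a ψ t := by
  rw [rlIntegral, rlIntegral]
  congr 1
  refine intervalIntegral.integral_congr_ae_restrict ?_
  filter_upwards [ae_restrict_uIoc_of_Icc h le_rfl ht.1 ht.2] with x hx
  rw [hx]

theorem MemAC.exists_bounded_density {X : Type*} [NormedAddCommGroup X] [NormedSpace ℝ X]
    {α a b : ℝ} {x : ℝ → X} (hx : MemAC α a b x) :
    ∃ (φ : ℝ → X) (C : ℝ), StronglyMeasurable φ ∧ (∀ t, ‖φ t‖ ≤ C) ∧
      ∀ t ∈ Icc a b, x t = x a + rlIntegral α a φ t := by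
  obtain ⟨φ, hφ, hxφ⟩ := hx
  obtain ⟨ψ, C, hψ, -, hC, hae⟩ := hφ.exists_bounded_version
  refine ⟨ψ, C, hψ, hC, fun t ht => ?_⟩
  rw [hxφ t ht, rlIntegral_congr_ae hae ht]

/-! ### Fundamental matrices and the resolvent -/

section Matrix

variable {n : ℕ} {α t₀ ϑ C : ℝ} {A A' : ℝ → Matrix (Fin n) (Fin n) ℝ}

theorem volterraOp_eq_integral (hAA' : ∀ᵐ x ∂(volume.restrict (Icc t₀ ϑ)), A' x = A x) {s t : ℝ}
    (hs : t₀ ≤ s) (hst : s ≤ t) (ht : t ≤ ϑ) (f : ℝ → Matrix (Fin n) (Fin n) ℝ) :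
    volterraOp α s A' f t = ((t - s) ^ (1 - α) / Real.Gamma α) •
      ∫ τ in s..t, ((t - τ) ^ (α - 1) * (τ - s) ^ (α - 1)) • (A τ * f τ) := by
  rw [volterraOp]
  congr 1
  refine intervalIntegral.integral_congr_ae_restrict ?_
  filter_upwards [ae_restrict_uIoc_of_Icc hAA' hs hst ht] with x hx
  rw [hx, smul_eq_mul]

theorem isFundamentalMatrix_of_resolvent (hα : α ∈ Ioo (0 : ℝ) 1) (hA : ∀ τ, ‖A' τ‖ ≤ C)
    (hAm : StronglyMeasurable A') (hAA' : ∀ᵐ x ∂(volume.restrict (Icc t₀ ϑ)), A' x = A x)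
    {R : ℝ → ℝ → Matrix (Fin n) (Fin n) ℝ} {D : ℝ} (hRm : StronglyMeasurable (Function.uncurry R))
    (hRD : ∀ t s, ‖R t s‖ ≤ D)
    (hR : ∀ s t, s ≤ t → t - s ≤ ϑ - t₀ →
      R t s = (1 / Real.Gamma α) • 1 + volterraOp α s A' (fun τ => R τ s) t) :
    IsFundamentalMatrix α t₀ ϑ A R where
  continuousOn s hs := by
    have h1 : ContinuousOn (fun t => (1 / Real.Gamma α) • (1 : Matrix (Fin n) (Fin n) ℝ) +
        volterraOp α s A' (fun τ => R τ s) t) (Icc s ϑ) :=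
      continuousOn_const.add (continuousOn_volterraOp hα hA hAm
        (hRm.comp_measurable (measurable_id.prodMk measurable_const)).aestronglyMeasurable
        fun t _ => hRD t s)
    exact h1.congr fun t ht => hR s t ht.1 (by linarith [ht.2, hs.1])
  equation s hs t ht := by
    rw [← volterraOp_eq_integral hAA' hs.1 ht.1 ht.2]
    exact hR s t ht.1 (by linarith [ht.2, hs.1])

/-- For fixed s, continuity on a compact interval makes F(·, s) bounded, so uniqueness applies. This
transfers to F the regularity in the second variable that its definition does not mention. -/
theorem IsFundamentalMatrix.eq_resolvent (hα : α ∈ Ioo (0 : ℝ) 1) (hA : ∀ τ, ‖A' τ‖ ≤ C)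
    (hAm : StronglyMeasurable A') (hAA' : ∀ᵐ x ∂(volume.restrict (Icc t₀ ϑ)), A' x = A x)
    {R F : ℝ → ℝ → Matrix (Fin n) (Fin n) ℝ} {D : ℝ}
    (hRm : StronglyMeasurable (Function.uncurry R)) (hRD : ∀ t s, ‖R t s‖ ≤ D)
    (hR : ∀ s t, s ≤ t → t - s ≤ ϑ - t₀ →
      R t s = (1 / Real.Gamma α) • 1 + volterraOp α s A' (fun τ => R τ s) t)
    (hF : IsFundamentalMatrix α t₀ ϑ A F) {s t : ℝ} (hs : t₀ ≤ s) (hst : s < t) (ht : t ≤ ϑ) :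
    F t s = R t s := by
  have hs' : s ∈ Icc t₀ ϑ := ⟨hs, hst.le.trans ht⟩
  have hFc : ContinuousOn (fun t => F t s) (Icc s ϑ) := hF.continuousOn s hs'
  obtain ⟨M, hM⟩ := isCompact_Icc.exists_bound_of_continuousOn hFc
  refine eqOn_of_eq_const_add_volterraOp (r := ϑ) (f := fun t => F t s) (g := fun t => R t s)
    (v := fun _ => (1 / Real.Gamma α) • (1 : Matrix (Fin n) (Fin n) ℝ)) hα hA hAm
    (MemC.aestronglyMeasurable hFc)
    (hRm.comp_measurable (measurable_id.prodMk measurable_const)).aestronglyMeasurable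
    (fun t ht => hM t (Ioc_subset_Icc_self ht)) (fun t _ => hRD t s) (fun t ht => ?_)
    (fun t ht => hR s t ht.1.le (by linarith [ht.2])) t ⟨hst, ht⟩
  rw [volterraOp_eq_integral hAA' hs ht.1.le ht.2]
  exact hF.equation s hs' t (Ioc_subset_Icc_self ht)

end Matrix

theorem corollary4p4 (n : ℕ) (α t₀ ϑ tstar : ℝ) (hα : α ∈ Ioo (0 : ℝ) 1)
    (htstar : tstar ∈ Ico t₀ ϑ)
    (A : ℝ → Matrix (Fin n) (Fin n) ℝ) (hA : MemLinf t₀ ϑ A)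
    (b : ℝ → Fin n → ℝ) (hb : MemLinf t₀ ϑ b)
    (w : ℝ → Fin n → ℝ) (hw : MemAC α t₀ tstar w) :
    -- the fundamental matrix and the solution exist
    (∃ F, IsFundamentalMatrix α t₀ ϑ A F) ∧
    (∃ x, IsCauchySolution α t₀ ϑ tstar A b w x) ∧
    ∀ F, IsFundamentalMatrix α t₀ ϑ A F →
    ∀ x, IsCauchySolution α t₀ ϑ tstar A b w x →
    ∀ t ∈ Ioc tstar ϑ,
      -- all the integrals converge
      IntegralConverges tstar t (fun τ => (t - τ) ^ (α - 1) • (F t τ * A τ)) ∧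
      (∀ τ ∈ Ioc tstar t,
        IntegralConverges t₀ tstar (fun ξ => (τ - ξ) ^ (-1 - α) • (w ξ - w t₀))) ∧
      IntegralConverges tstar t
        (fun τ => (t - τ) ^ (α - 1) •
          (F t τ *ᵥ ∫ ξ in t₀..tstar, (τ - ξ) ^ (-1 - α) • (w ξ - w t₀))) ∧
      IntegralConverges tstar t (fun τ => (t - τ) ^ (α - 1) • (F t τ *ᵥ b τ)) ∧
      -- the representation formula
      x t = (1 + ∫ τ in tstar..t, (t - τ) ^ (α - 1) • (F t τ * A τ)) *ᵥ w t₀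
        + (α / Real.Gamma (1 - α)) •
          (∫ τ in tstar..t, (t - τ) ^ (α - 1) •
            (F t τ *ᵥ ∫ ξ in t₀..tstar, (τ - ξ) ^ (-1 - α) • (w ξ - w t₀)))
        + ∫ τ in tstar..t, (t - τ) ^ (α - 1) • (F t τ *ᵥ b τ) := by
  obtain ⟨h0s, hsϑ⟩ := htstar
  obtain ⟨A', C, hAm, -, hAC, hAA'⟩ := hA.exists_bounded_version
  obtain ⟨b', B, hbm, -, hbB, hbb'⟩ := hb.exists_bounded_version
  obtain ⟨R, D, hRm, -, hRD, hR⟩ := exists_resolvent hα hAC hAm (ϑ - t₀)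
  refine ⟨⟨R, isFundamentalMatrix_of_resolvent hα hAC hAm hAA' hRm hRD hR⟩, ?_, ?_⟩
  · obtain ⟨φ, L, hφ, hL, hwφ⟩ := hw.exists_bounded_density
    obtain ⟨x, ψ, M, hψ, hM, hx, hxw, hψx⟩ := exists_solution (v := w t₀) hα h0s hsϑ hAC hAm hbB
      hbm hφ hL
    have hinit : ∀ t ∈ Icc t₀ tstar, x t = w t := fun t ht => by rw [hxw t ht, hwφ t ht]
    have hx0 : x t₀ = w t₀ := hinit t₀ (left_mem_Icc.2 h0s)
    have hx' : ∀ t ∈ Icc t₀ ϑ, x t = x t₀ + rlIntegral α t₀ ψ t := fun t ht => by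
      rw [hx0]; exact hx t ht
    refine ⟨x, ⟨ψ, memLinf_of_bounded hψ hM, hx'⟩, hinit, ?_⟩
    have hsub : Ioc tstar ϑ ⊆ Icc t₀ ϑ := Ioc_subset_Icc_self.trans (Icc_subset_Icc_left h0s)
    -- The new density is prescribed by the equation only strictly after `tstar`; that single point
    -- is null.
    rw [← restrict_Ioc_eq_restrict_Icc]
    filter_upwards [ae_restrict_of_ae_restrict_of_subset hsub
      (ae_hasCaputoDerivAt_iff hα hψ hM hx'), ae_restrict_of_ae_restrict_of_subset hsub hAA',
      ae_restrict_of_ae_restrict_of_subset hsub hbb', ae_restrict_mem measurableSet_Ioc]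
      with t h1 h2 h3 h4
    rw [h1, hψx t h4, h2, h3, Matrix.smul_eq_mulVec]
  · intro F hF x hx t ht
    obtain ⟨φ, L, hφ, hL, hxφ⟩ := hx.memAC.exists_bounded_density
    have hx0 : x t₀ = w t₀ := hx.initial t₀ (left_mem_Icc.2 h0s)
    have hsub : Ioc tstar ϑ ⊆ Icc t₀ ϑ := Ioc_subset_Icc_self.trans (Icc_subset_Icc_left h0s)
    have heq : ∀ᵐ t ∂(volume.restrict (Ioc tstar ϑ)), φ t = A' t • x t + b' t := by
      filter_upwards [ae_restrict_of_ae_restrict_of_subset hsub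
        (ae_hasCaputoDerivAt_iff hα hφ hL hxφ), ae_restrict_of_ae_restrict_of_subset hsub hAA',
        ae_restrict_of_ae_restrict_of_subset hsub hbb',
        ae_restrict_of_ae_restrict_of_subset Ioc_subset_Icc_self hx.equation] with t h1 h2 h3 h4
      rw [h2, h3, Matrix.smul_eq_mulVec]
      exact ((h1 _).1 h4).symm
    rw [hx0] at hxφ
    obtain ⟨i1, i2, i3, i4, hrep⟩ := representation hα h0s hsϑ hAC hAm hbB hbm hφ hL hRm hRD hR
      (by linarith) hxφ heq ht
    have hu : ∀ τ : ℝ, ∫ ξ in t₀..tstar, (τ - ξ) ^ (-1 - α) • rlIntegral α t₀ φ ξ =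
        ∫ ξ in t₀..tstar, (τ - ξ) ^ (-1 - α) • (w ξ - w t₀) := fun τ =>
      intervalIntegral_congr_Ioo h0s fun ξ hξ => by
        rw [← hx.initial ξ ⟨hξ.1.le, hξ.2.le⟩, hxφ ξ ⟨hξ.1.le, hξ.2.le.trans hsϑ.le⟩,
          add_sub_cancel_left]
    -- Agreement strictly below the diagonal suffices, since τ = t is a null set in each integral.
    have hFR : ∀ᵐ τ ∂(volume.restrict (Ι tstar t)), R t τ = F t τ :=
      ae_restrict_uIoc_of_forall_Ioo ht.1.le fun τ hτ =>
        (hF.eq_resolvent hα hAC hAm hAA' hRm hRD hR (h0s.trans hτ.1.le) hτ.2 ht.2).symm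
    have hA1 := ae_restrict_uIoc_of_Icc hAA' h0s ht.1.le ht.2
    have hb1 := ae_restrict_uIoc_of_Icc hbb' h0s ht.1.le ht.2
    have e1 : (fun τ => (t - τ) ^ (α - 1) • (R t τ * A' τ)) =ᵐ[volume.restrict (Ι tstar t)]
        fun τ => (t - τ) ^ (α - 1) • (F t τ * A τ) := by
      filter_upwards [hFR, hA1] with τ h1 h2
      rw [h1, h2]
    have e3 : (fun τ => (t - τ) ^ (α - 1) •
        (R t τ • ∫ ξ in t₀..tstar, (τ - ξ) ^ (-1 - α) • rlIntegral α t₀ φ ξ))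
        =ᵐ[volume.restrict (Ι tstar t)] fun τ => (t - τ) ^ (α - 1) •
          (F t τ *ᵥ ∫ ξ in t₀..tstar, (τ - ξ) ^ (-1 - α) • (w ξ - w t₀)) := by
      filter_upwards [hFR] with τ h1
      rw [h1, hu, Matrix.smul_eq_mulVec]
    have e4 : (fun τ => (t - τ) ^ (α - 1) • (R t τ • b' τ)) =ᵐ[volume.restrict (Ι tstar t)]
        fun τ => (t - τ) ^ (α - 1) • (F t τ *ᵥ b τ) := by
      filter_upwards [hFR, hb1] with τ h1 h2
      rw [h1, h2, Matrix.smul_eq_mulVec]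
    refine ⟨i1.congr_ae e1, fun τ hτ => (i2 τ hτ).congr_ae ?_, i3.congr_ae e3, i4.congr_ae e4, ?_⟩
    · refine ae_restrict_uIoc_of_forall_Ioo h0s fun ξ hξ => ?_
      beta_reduce
      rw [← hx.initial ξ ⟨hξ.1.le, hξ.2.le⟩, hxφ ξ ⟨hξ.1.le, hξ.2.le.trans hsϑ.le⟩,
        add_sub_cancel_left]
    · rw [hrep, intervalIntegral.integral_congr_ae_restrict e1,
        intervalIntegral.integral_congr_ae_restrict e3,
        intervalIntegral.integral_congr_ae_restrict e4, Matrix.smul_eq_mulVec]
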